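/- Conventions. A quantum algorithm is a family $\{A_\lambda\}_{\lambda\in\mathbb N}$ of generalized quantum circuits over the gate set $\{\mathrm{CNOT},H,T\}$: some input qubits may be initialized to zero and some output qubits may be traced out. It is QPT if the size of $A_\lambda$ (number of gates plus number of input and output qubits) is at most $p(\lambda)$ for some polynomial $p$, and uniform if a deterministic polynomial-time Turing machine outputs the description of $A_\lambda$ on input $1^\lambda$. A non-uniform QPT algorithm is a polynomial-size circuit family, not necessarily uniform, some of whose input qubits are initialized with an arbitrary density matrix $\rho_\lambda$ (quantum advice). Classical outputs are obtained by measuring in the computational basis. A function is negligible if it decays faster than every inverse polynomial. A strong QPRG with output length $\ell$ is a uniform QPT algorithm $G$ such that $G_\lambda$ maps seeds $k\in\{0,1\}^\lambda$ to strings in $\{0,1\}^{\ell(\lambda)}$, $\ell(\lambda)>\lambda$, and: * (pseudodeterminism) there are $c>0$ and $\mu(\lambda)=O(\lambda^{-c})$ such that for every $\lambda$ there is a set $\mathcal K_\lambda\subseteq\{0,1\}^\lambda$ with $\Pr_{k\gets\{0,1\}^\lambda}[k\in\mathcal K_\lambda]\ge 1-\mu(\lambda)$ and $\max_y\Pr[y=G_\lambda(k)]\ge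 1-\mu(\lambda)$ for every $k\in\mathcal K_\lambda$; * (strong security) for every non-uniform QPT distinguisher $A$ there is a negligible $\varepsilon$ such that, for all sufficiently large $\lambda$, $$\bigl|\Pr[A_\lambda(y)=1: k\gets\{0,1\}^\lambda,\ y\gets G_\lambda(k)]-\Pr[A_\lambda(y)=1: y\gets\{0,1\}^{\ell(\lambda)}]\bigr|\le\varepsilon(\lambda).$$ A pseudorandom one-time pad for messages of length $\ell(\lambda)$ is a triple of QPT algorithms $(\mathsf{Gen},\mathsf{Enc},\mathsf{Dec})$, with keys of length $\kappa(\lambda)$ and classical ciphertexts, such that: * (correctness) there is a negligible $\varepsilon$ such that for every $\lambda$ and every $m\in\{0,1\}^{\ell(\lambda)}$, $\Pr[m'=m: k\gets\mathsf{Gen}(1^\lambda),\ c\gets\mathsf{Enc}(1^\lambda,k,m),\ m'\gets\mathsf{Dec}(1^\lambda,k,c)]\ge 1-\varepsilon(\lambda)$; * (stretch) $\ell(\lambda)>\kappa(\lambda)$ for every $\lambda$; * (security) for every non-uniform QPT adversary $A$ there is a negligible $\varepsilon$ such that for every $\lambda$ and all $m_0,m_1\in\{0,1\}^{\ell(\lambda)}$,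 the probabilities of $A_\lambda(c)=1$ for $k\gets\mathsf{Gen}(1^\lambda)$, $c\gets\mathsf{Enc}(1^\lambda,k,m_b)$ with $b=0$ and with $b=1$ differ by at most $\varepsilon(\lambda)$. Theorem. Let $G$ be a strong QPRG with output length $\ell(\lambda)>\lambda^2$ for every $\lambda$. Consider the following scheme. * $\mathsf{Gen}(1^\lambda)$ outputs a uniformly random key $k\in\{0,1\}^{\lambda^2}$, parsed as $k_1\|\cdots\|k_\lambda$ with $k_i\in\{0,1\}^\lambda$. * $\mathsf{Enc}(1^\lambda,k,m)$ computes $c_i=m\oplus G_\lambda(k_i)$ for $i=1,\dots,\lambda$ and outputs $c=c_1\|\cdots\|c_\lambda\in\{0,1\}^{\lambda\ell(\lambda)}$. * $\mathsf{Dec}(1^\lambda,k,c)$ computes $m_i=c_i\oplus G_\lambda(k_i)$, with fresh runs of $G_\lambda$, for $i=1,\dots,\lambda$ and outputs the bitwise majority of $m_1,\dots,m_\lambda$ (this is the string that occurs more than $\lambda/2$ times among the $m_i$, whenever there is one). Then $\mathsf{Gen}$, $\mathsf{Enc}$ and $\mathsf{Dec}$ are realized by QPT algorithms, and the scheme is a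 pseudorandom one-time pad with key length $\lambda^2$ and message length $\ell(\lambda)$; that is, it satisfies correctness, stretch and security. -/

import Mathlib

namespace QCrypto

open scoped BigOperators Matrix ComplexOrder Asymptotics

/-! ### Bit strings -/

/-- The set `{0,1}^n`. -/
abbrev Bits (n : ℕ) : Type := Fin n → Bool

/-- Bitwise exclusive or. -/
def bxor {n : ℕ} (x y : Bits n) : Bits n := fun i => Bool.xor (x i) (y i)

/-- The concatenation `s₁ || … || s_a` of `a` strings of length `b`. -/
def concat {a b : ℕ} (s : Fin a → Bits b) : Bits (a * b) :=
  fun t => s (finProdFinEquiv.symm t).1 (finProdFinEquiv.symm t).2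

/-- The `i`-th block when a string of length `a * b` is parsed as `a` strings of length `b`. -/
def block {a b : ℕ} (s : Bits (a * b)) (i : Fin a) : Bits b :=
  fun j => s (finProdFinEquiv (i, j))

/-- The majority function, applied to each bit position: bit `j` of the output is `1` iff
more than half of the strings have a `1` at position `j`. -/
def maj {a b : ℕ} (s : Fin a → Bits b) : Bits b :=
  fun j => decide (a < 2 * (Finset.univ.filter fun i => s i j = true).card)

/-- If one string occurs more than `a / 2` times among `s₁, …, s_a`, then `maj` returns it. -/
theorem maj_eq_of_majority {a b : ℕ} (s : Fin a → Bits b) (x : Bits b)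
    (h : a < 2 * (Finset.univ.filter fun i => s i = x).card) : maj s = x := by
  funext j
  unfold maj
  cases hx : x j with
  | true =>
    have h1 : (Finset.univ.filter fun i => s i = x).card ≤
        (Finset.univ.filter fun i => s i j = true).card := by
      apply Finset.card_le_card
      intro i hi
      simp only [Finset.mem_filter, Finset.mem_univ, true_and] at hi ⊢
      rw [hi, hx]
    simp only [decide_eq_true_eq]
    omega
  | false =>
    have h1 : Disjoint (Finset.univ.filter fun i => s i = x)
        (Finset.univ.filter fun i => s i j = true) := by
      rw [Finset.disjoint_left]
      intro i hi hi'
      simp only [Finset.mem_filter, Finset.mem_univ, true_and] at hi hi'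
      rw [hi, hx] at hi'
      cases hi'
    have h2 := Finset.card_le_univ ((Finset.univ.filter fun i => s i = x) ∪
        (Finset.univ.filter fun i => s i j = true))
    rw [Finset.card_union_of_disjoint h1, Fintype.card_fin] at h2
    simp only [decide_eq_false_iff_not]
    omega

/-! ### Generalized quantum circuits over the gate set `{CNOT, H, T}` -/

/-- A gate acting on a register of `w` qubits. -/
inductive Gate (w : ℕ) : Type
  | H (i : Fin w) : Gate w
  | T (i : Fin w) : Gate w
  | CNOT (ctrl tgt : Fin w) (hne : ctrl ≠ tgt) : Gate w

/-- The unitary of a gate on `(ℂ²)^{⊗ w}` in the computational basis. -/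
noncomputable def Gate.toMatrix {w : ℕ} : Gate w → Matrix (Bits w) (Bits w) ℂ
  | .H i => Matrix.of fun x y =>
      if ∀ j, j ≠ i → x j = y j then
        (if x i = true ∧ y i = true then -1 else 1) / (Real.sqrt 2 : ℂ)
      else 0
  | .T i => Matrix.diagonal fun x =>
      if x i = true then Complex.exp (Complex.I * (Real.pi / 4)) else 1
  | .CNOT ctrl tgt _ => Matrix.of fun x y =>
      if x = Function.update y tgt (Bool.xor (y tgt) (y ctrl)) then 1 else 0

/-- A generalized quantum circuit with `n` inputs and `m` outputs. It acts on `width` wires. The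
wires outside the range of `inp` are initialized to zero; the wires outside the range of `out` are
traced out at the end. -/
structure QCircuit (n m : ℕ) where
  width : ℕ
  gates : List (Gate width)
  inp : Fin n ↪ Fin width
  out : Fin m ↪ Fin width

namespace QCircuit

variable {n m : ℕ}

/-- The number of gates plus the number of input and output qubits of the unitary part (so that the
zero-initialized and the traced-out qubits are counted as well). -/
def size (C : QCircuit n m) : ℕ := C.gates.length + C.width + C.width

/-- The unitary part; the first gate of the list is applied first. -/
noncomputable def unitaryPart (C : QCircuit n m) : Matrix (Bits C.width) (Bits C.width) ℂ :=
  C.gates.foldl (fun U g => g.toMatrix * U) 1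

/-- The state `ρ` on the input wires, tensored with `|0⟩⟨0|` on all other wires. -/
def initState (C : QCircuit n m) (ρ : Matrix (Bits n) (Bits n) ℂ) :
    Matrix (Bits C.width) (Bits C.width) ℂ :=
  Matrix.of fun x y =>
    if ∀ j, (∀ i, C.inp i ≠ j) → x j = false ∧ y j = false then
      ρ (fun i => x (C.inp i)) (fun i => y (C.inp i))
    else 0

/-- The partial trace over all wires that are not output wires. -/
def traceOut (C : QCircuit n m) (σ : Matrix (Bits C.width) (Bits C.width) ℂ) :
    Matrix (Bits m) (Bits m) ℂ :=
  Matrix.of fun a b => ∑ x : Bits C.width, ∑ y : Bits C.width,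
    if (∀ i, x (C.out i) = a i) ∧ (∀ i, y (C.out i) = b i) ∧
        (∀ j, (∀ i, C.out i ≠ j) → x j = y j) then
      σ x y
    else 0

/-- The quantum channel computed by the circuit. -/
noncomputable def channel (C : QCircuit n m) (ρ : Matrix (Bits n) (Bits n) ℂ) :
    Matrix (Bits m) (Bits m) ℂ :=
  C.traceOut (C.unitaryPart * C.initState ρ * C.unitaryPartᴴ)

/-- `Pr[y = C(x)]` for bit strings `x` and `y`: the circuit is run on `|x⟩⟨x|` and its output is
measured in the computational basis. -/
noncomputable def prob (C : QCircuit n m) (x : Bits n) (y : Bits m) : ℝ :=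
  (C.channel (Matrix.single x x 1) y y).re

end QCircuit

/-! ### Quantum polynomial-time algorithms -/

/-- A quantum algorithm `{A_λ}` is QPT if the size of its circuits is bounded by a polynomial. -/
def IsQPT {a b : ℕ → ℕ} (C : ∀ n, QCircuit (a n) (b n)) : Prop :=
  ∃ p : Polynomial ℕ, ∀ n, (C n).size ≤ p.eval n

/-- The alphabet in which circuits are described. -/
inductive DescSymbol : Type
  | tick | sep | h | t | cnot

/-- Unary description of a natural number, with an end marker. -/
def descNat (k : ℕ) : List DescSymbol := List.replicate k .tick ++ [.sep]

/-- Description of a gate: its type and the wires it acts on. -/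
def Gate.desc {w : ℕ} : Gate w → List DescSymbol
  | .H i => .h :: descNat i
  | .T i => .t :: descNat i
  | .CNOT ctrl tgt _ => .cnot :: (descNat ctrl ++ descNat tgt)

/-- Description of a circuit: numbers of inputs, of outputs and of wires, the input wires, the
output wires, the gates. -/
def QCircuit.desc {n m : ℕ} (C : QCircuit n m) : List DescSymbol :=
  descNat n ++ descNat m ++ descNat C.width ++
    (List.ofFn fun i => descNat (C.inp i)).flatten ++
    (List.ofFn fun i => descNat (C.out i)).flatten ++
    (C.gates.map Gate.desc).flatten

/-- A family of circuits is uniform if a deterministic polynomial-time Turing machine outputs the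
description of the `λ`-th circuit on input `1^λ`. -/
def IsUniform {a b : ℕ → ℕ} (C : ∀ n, QCircuit (a n) (b n)) : Prop :=
  Nonempty (Turing.TM2ComputableInPolyTime Computability.unaryEncodeNat
    (id : List DescSymbol → List DescSymbol) fun n => (C n).desc)

/-- Density matrices on `a` qubits. -/
def IsDensity {a : ℕ} (ρ : Matrix (Bits a) (Bits a) ℂ) : Prop :=
  ρ.PosSemidef ∧ ρ.trace = 1

/-- A non-uniform QPT algorithm `{(A_λ, ρ_λ)}` that gets a string of length `d λ` and outputs one
bit: a polynomial-size family of circuits, where the input qubits of `A_λ` after the first `d λ` are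
initialized with the density matrix `ρ_λ`. -/
structure Adversary (d : ℕ → ℕ) where
  adviceLen : ℕ → ℕ
  circuit : ∀ n, QCircuit (d n + adviceLen n) 1
  advice : ∀ n, Matrix (Bits (adviceLen n)) (Bits (adviceLen n)) ℂ
  isQPT : IsQPT circuit
  isDensity : ∀ n, IsDensity (advice n)

/-- The product state `|x⟩⟨x| ⊗ ρ`. -/
def withAdvice {d a : ℕ} (x : Bits d) (ρ : Matrix (Bits a) (Bits a) ℂ) :
    Matrix (Bits (d + a)) (Bits (d + a)) ℂ :=
  Matrix.of fun u v =>
    (Matrix.single x x 1 : Matrix (Bits d) (Bits d) ℂ)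
        (fun i => u (Fin.castAdd a i)) (fun i => v (Fin.castAdd a i)) *
      ρ (fun i => u (Fin.natAdd d i)) (fun i => v (Fin.natAdd d i))

/-- `Pr[A_λ(x) = 1]`. -/
noncomputable def Adversary.accept {d : ℕ → ℕ} (A : Adversary d) (n : ℕ) (x : Bits (d n)) : ℝ :=
  ((A.circuit n).channel (withAdvice x (A.advice n)) (fun _ => true) (fun _ => true)).re

/-- Negligible functions of the security parameter. -/
def Negligible (ε : ℕ → ℝ) : Prop :=
  Asymptotics.SuperpolynomialDecay Filter.atTop (fun n : ℕ => (n : ℝ)) ε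

/-! ### Strong pseudodeterministic quantum pseudorandom generators -/

/-- `G` has pseudodeterminism `1 - μ`. -/
def Pseudodeterministic {ℓ : ℕ → ℕ} (G : ∀ n, QCircuit n (ℓ n)) (μ : ℕ → ℝ) : Prop :=
  ∀ n, ∃ K : Finset (Bits n),
    1 - μ n ≤ (K.card : ℝ) / 2 ^ n ∧
    ∀ k ∈ K, ∃ y : Bits (ℓ n), 1 - μ n ≤ (G n).prob k y

/-- `Pr[A_λ(y) = 1 : k ← {0,1}^λ, y ← G_λ(k)]`. -/
noncomputable def prgReal {ℓ : ℕ → ℕ} (G : ∀ n, QCircuit n (ℓ n)) (A : Adversary ℓ) (n : ℕ) : ℝ :=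
  ∑ k : Bits n, (1 / 2 ^ n : ℝ) * ∑ y : Bits (ℓ n), (G n).prob k y * A.accept n y

/-- `Pr[A_λ(y) = 1 : y ← {0,1}^ℓ(λ)]`. -/
noncomputable def prgIdeal {ℓ : ℕ → ℕ} (A : Adversary ℓ) (n : ℕ) : ℝ :=
  ∑ y : Bits (ℓ n), (1 / 2 ^ ℓ n : ℝ) * A.accept n y

/-- Strong pseudodeterministic quantum pseudorandom generators with seed length `λ` and output
length `ℓ λ`. (Weak security, a distinguishing advantage of at most `1 - 1 / poly`, is a special
case of strong security.) -/
structure IsStrongQPRG {ℓ : ℕ → ℕ} (G : ∀ n, QCircuit n (ℓ n)) : Prop where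
  isQPT : IsQPT G
  isUniform : IsUniform G
  pseudodeterminism : ∃ c : ℝ, 0 < c ∧ ∃ μ : ℕ → ℝ,
    μ =O[Filter.atTop] (fun n : ℕ => (n : ℝ) ^ (-c)) ∧ Pseudodeterministic G μ
  stretch : ∀ n, n < ℓ n
  strongSecurity : ∀ A : Adversary ℓ, ∃ ε : ℕ → ℝ, Negligible ε ∧
    ∀ᶠ n in Filter.atTop, |prgReal G A n - prgIdeal A n| ≤ ε n

/-! ### Pseudorandom one-time pads -/

/-- Circuit families `(Gen, Enc, Dec)` with keys of length `κ λ`, messages of length `ℓ λ` and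
classical ciphertexts of length `γ λ`. The input of `Enc` is `k || m`, that of `Dec` is `k || c`. -/
structure EncScheme (κ ℓ γ : ℕ → ℕ) where
  Gen : ∀ n, QCircuit 0 (κ n)
  Enc : ∀ n, QCircuit (κ n + ℓ n) (γ n)
  Dec : ∀ n, QCircuit (κ n + γ n) (ℓ n)

namespace EncScheme

variable {κ ℓ γ : ℕ → ℕ}

/-- `Pr[k = Gen(1^λ)]`. -/
noncomputable def genProb (S : EncScheme κ ℓ γ) (n : ℕ) (k : Bits (κ n)) : ℝ :=
  (S.Gen n).prob Fin.elim0 k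

/-- `Pr[c = Enc(1^λ, k, m)]`. -/
noncomputable def encProb (S : EncScheme κ ℓ γ) (n : ℕ) (k : Bits (κ n)) (m : Bits (ℓ n))
    (c : Bits (γ n)) : ℝ :=
  (S.Enc n).prob (Fin.append k m) c

/-- `Pr[m = Dec(1^λ, k, c)]`. -/
noncomputable def decProb (S : EncScheme κ ℓ γ) (n : ℕ) (k : Bits (κ n)) (c : Bits (γ n))
    (m : Bits (ℓ n)) : ℝ :=
  (S.Dec n).prob (Fin.append k c) m

/-- `Pr[m = m' : k ← Gen(1^λ), c ← Enc(1^λ, k, m), m' ← Dec(1^λ, k, c)]`. -/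
noncomputable def correctProb (S : EncScheme κ ℓ γ) (n : ℕ) (m : Bits (ℓ n)) : ℝ :=
  ∑ k : Bits (κ n), S.genProb n k * ∑ c : Bits (γ n), S.encProb n k m c * S.decProb n k c m

/-- `Pr[A_λ(c) = 1 : k ← Gen(1^λ), c ← Enc(1^λ, k, m)]`. -/
noncomputable def acceptProb (S : EncScheme κ ℓ γ) (A : Adversary γ) (n : ℕ) (m : Bits (ℓ n)) : ℝ :=
  ∑ k : Bits (κ n), S.genProb n k * ∑ c : Bits (γ n), S.encProb n k m c * A.accept n c

/-- Pseudorandom one-time pads. -/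
structure IsPOTP (S : EncScheme κ ℓ γ) : Prop where
  genQPT : IsQPT S.Gen
  encQPT : IsQPT S.Enc
  decQPT : IsQPT S.Dec
  correctness : ∃ ε : ℕ → ℝ, Negligible ε ∧
    ∀ (n : ℕ) (m : Bits (ℓ n)), 1 - ε n ≤ S.correctProb n m
  stretch : ∀ n, κ n < ℓ n
  security : ∀ A : Adversary γ, ∃ ε : ℕ → ℝ, Negligible ε ∧
    ∀ (n : ℕ) (m₀ m₁ : Bits (ℓ n)), |S.acceptProb A n m₀ - S.acceptProb A n m₁| ≤ ε n

end EncScheme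

/-- The probability that independent runs of `G_λ` on the blocks `k₁, …, k_λ` of the key `k` output
`y₁, …, y_λ`. -/
noncomputable def parallelProb {ℓ : ℕ → ℕ} (G : ∀ n, QCircuit n (ℓ n)) (n : ℕ) (k : Bits (n * n))
    (y : Fin n → Bits (ℓ n)) : ℝ :=
  ∏ i, (G n).prob (block k i) (y i)

/-- The scheme realizes the parallel-repetition construction from `G`:
* `Gen` outputs a uniformly random key `k = k₁ || … || k_λ` of `λ²` bits;
* `Enc` runs `y_i ← G_λ(k_i)` for every `i` and outputs `(m ⊕ y₁) || … || (m ⊕ y_λ)`;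
* `Dec` parses the ciphertext as `c₁ || … || c_λ`, runs `y_i ← G_λ(k_i)` afresh for every `i` and
  outputs the majority of `c₁ ⊕ y₁, …, c_λ ⊕ y_λ`. -/
structure RealizesConstruction {ℓ : ℕ → ℕ} (G : ∀ n, QCircuit n (ℓ n))
    (S : EncScheme (fun n => n * n) ℓ (fun n => n * ℓ n)) : Prop where
  gen : ∀ (n : ℕ) (k : Bits (n * n)), S.genProb n k = 1 / 2 ^ (n * n)
  enc : ∀ (n : ℕ) (k : Bits (n * n)) (m : Bits (ℓ n)) (c : Bits (n * ℓ n)),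
    S.encProb n k m c =
      ∑ y : Fin n → Bits (ℓ n),
        if (concat fun i => bxor m (y i)) = c then parallelProb G n k y else 0
  dec : ∀ (n : ℕ) (k : Bits (n * n)) (c : Bits (n * ℓ n)) (m : Bits (ℓ n)),
    S.decProb n k c m =
      ∑ y : Fin n → Bits (ℓ n),
        if (maj fun i => bxor (block c i) (y i)) = m then parallelProb G n k y else 0

end QCrypto

/-!
Correctness: a ciphertext block decrypts to the message as soon as the runs of the generator used
for encrypting and for decrypting it agree. By pseudodeterminism this has probability close to `1`
for a random seed, independently for the different blocks, so that by Chernoff's method all but an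
exponentially small fraction of the executions have a majority of such blocks.

Security: in a hybrid argument the blocks of the pad are replaced by uniformly random strings one at
a time. Averaging over the other blocks reduces each step to fixed ones; a distinguisher gets these
as advice, adds its challenge to the remaining block by `CNOT` gates and runs the adversary. By
non-uniformity it may use the worst advice for every security parameter. With a uniformly random
pad the ciphertext does not depend on the message.

Efficiency: fresh copies of the generator are run side by side, and the majority is computed
reversibly by a table of all thresholds, each round of which costs polynomially many gates.
-/

namespace QCrypto

open scoped Matrix ComplexOrder Asymptotics
open Filter Topology

/-! ### State vectors on arbitrary sets of wires -/

/-- A gate of the set `{CNOT, H, T}` on wires labelled by an arbitrary type. Structured labels let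
circuits be composed without numbering their wires. -/
inductive WireGate (W : Type*)
  | H (i : W)
  | T (i : W)
  | CNOT (ctrl tgt : W) (hne : ctrl ≠ tgt)

/-- State vectors of the qubits on the wires `W`, as amplitudes in the computational basis. -/
abbrev StateVec (W : Type*) : Type _ := (W → Bool) → ℂ

/-- The computational basis state `|u⟩`. -/
noncomputable abbrev ket {W : Type*} [Fintype W] (u : W → Bool) : StateVec W := Pi.single u 1

/-- The phase of the `T` gate, a primitive eighth root of unity. -/
noncomputable def tPhase : ℂ := Complex.exp (Complex.I * (Real.pi / 4))

theorem tPhase_pow_four : tPhase ^ 4 = -1 := by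
  rw [tPhase, ← Complex.exp_nat_mul, ← Complex.exp_pi_mul_I]
  congr 1
  push_cast
  ring

theorem normSq_tPhase : Complex.normSq tPhase = 1 := by
  have h : tPhase = Complex.exp ((Real.pi / 4 : ℝ) * Complex.I) := by
    rw [tPhase]
    push_cast
    ring_nf
  rw [h, Complex.normSq_eq_norm_sq, Complex.norm_exp_ofReal_mul_I, one_pow]

theorem normSq_sqrt_two : Complex.normSq (Real.sqrt 2 : ℂ) = 2 := by
  rw [Complex.normSq_ofReal, Real.mul_self_sqrt zero_le_two]

theorem extend_comp_self {V W : Type*} (e : V ↪ W) (x : W → Bool) :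
    Function.extend e (x ∘ e) x = x := by
  funext w
  by_cases h : ∃ j, e j = w
  · obtain ⟨j, rfl⟩ := h
    exact e.injective.extend_apply _ _ j
  · exact Function.extend_apply' _ _ _ h

theorem extend_extend {V W : Type*} (e : V ↪ W) (x : W → Bool) (u u' : V → Bool) :
    Function.extend e u (Function.extend e u' x) = Function.extend e u x := by
  funext w
  by_cases h : ∃ j, e j = w
  · obtain ⟨j, rfl⟩ := h
    simp only [e.injective.extend_apply]
  · simp only [Function.extend_apply' _ _ _ h]

section Evolution

variable {V W : Type*} [DecidableEq V] [DecidableEq W]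

/-- The action of a gate on state vectors. -/
noncomputable def WireGate.act : WireGate W → StateVec W → StateVec W
  | .H i, ψ => fun x =>
      (ψ (Function.update x i false) + (if x i then -1 else 1) * ψ (Function.update x i true)) /
        (Real.sqrt 2 : ℂ)
  | .T i, ψ => fun x => (if x i then tPhase else 1) * ψ x
  | .CNOT c t _, ψ => fun x => ψ (Function.update x t (Bool.xor (x t) (x c)))

/-- The evolution of a state vector under a list of gates, the first of which is applied first. -/
noncomputable def evolve (L : List (WireGate W)) (ψ : StateVec W) : StateVec W :=
  L.foldl (fun φ g => g.act φ) ψ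

@[simp] theorem evolve_nil (ψ : StateVec W) : evolve [] ψ = ψ := rfl

@[simp] theorem evolve_cons (g : WireGate W) (L : List (WireGate W)) (ψ : StateVec W) :
    evolve (g :: L) ψ = evolve L (g.act ψ) := rfl

theorem evolve_append (L L' : List (WireGate W)) (ψ : StateVec W) :
    evolve (L ++ L') ψ = evolve L' (evolve L ψ) := List.foldl_append

theorem WireGate.act_smul (g : WireGate W) (a : ℂ) (ψ : StateVec W) :
    g.act (a • ψ) = a • g.act ψ := by
  cases g <;> funext x <;> simp only [act, Pi.smul_apply, smul_eq_mul] <;> ring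

theorem evolve_smul (L : List (WireGate W)) (a : ℂ) (ψ : StateVec W) :
    evolve L (a • ψ) = a • evolve L ψ := by
  induction L generalizing ψ with
  | nil => rfl
  | cons g L ih => rw [evolve_cons, WireGate.act_smul, ih, evolve_cons]

/-- Relabelling of the wires of a gate. -/
def WireGate.map (e : V ↪ W) : WireGate V → WireGate W
  | .H i => .H (e i)
  | .T i => .T (e i)
  | .CNOT c t h => .CNOT (e c) (e t) (e.injective.ne h)

theorem extend_update_comp (e : V ↪ W) (x : W → Bool) (i : V) (b : Bool) :
    Function.extend e (Function.update (x ∘ e) i b) x = Function.update x (e i) b := by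
  rw [Function.eq_update_iff]
  refine ⟨by rw [e.injective.extend_apply, Function.update_self], fun w hw => ?_⟩
  by_cases h : ∃ j, e j = w
  · obtain ⟨j, rfl⟩ := h
    rw [e.injective.extend_apply, Function.update_of_ne fun hj => hw (congrArg e hj)]
    rfl
  · exact Function.extend_apply' _ _ _ h

theorem WireGate.act_map (e : V ↪ W) (g : WireGate V) (ψ : StateVec W) (x : W → Bool) :
    (g.map e).act ψ x = g.act (fun u => ψ (Function.extend e u x)) (x ∘ e) := by
  cases g with
  | H i => simp only [map, act, extend_update_comp, Function.comp_apply]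
  | T i => simp only [map, act, extend_comp_self, Function.comp_apply]
  | CNOT c t h => simp only [map, act, extend_update_comp, Function.comp_apply]

theorem evolve_map (e : V ↪ W) (L : List (WireGate V)) (ψ : StateVec W) (x : W → Bool) :
    evolve (L.map (WireGate.map e)) ψ x =
      evolve L (fun u => ψ (Function.extend e u x)) (x ∘ e) := by
  induction L generalizing ψ with
  | nil => simp only [List.map_nil, evolve_nil, extend_comp_self]
  | cons g L ih =>
    simp only [List.map_cons, evolve_cons, ih, WireGate.act_map, extend_extend,
      Function.extend_comp e.injective]

theorem evolve_map_equiv_ket [Fintype V] [Fintype W] (e : V ≃ W) (L : List (WireGate V))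
    (u x : W → Bool) :
    evolve (L.map (WireGate.map e.toEmbedding)) (ket u) x = evolve L (ket (u ∘ e)) (x ∘ e) := by
  rw [evolve_map]
  congr 1
  funext v
  have hv : Function.extend e v x = v ∘ e.symm := by
    funext w
    obtain ⟨i, rfl⟩ := e.surjective w
    simp [e.injective.extend_apply]
  simp only [Equiv.coe_toEmbedding, hv, Pi.single_apply, Equiv.comp_symm_eq]

theorem cnot_involutive {c t : W} (h : c ≠ t) :
    Function.Involutive fun x : W → Bool => Function.update x t (Bool.xor (x t) (x c)) :=
  fun x => by simp [Function.update_of_ne h]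

variable [Fintype W]

theorem two_mul_sum_eq_sum_update (i : W) (F : (W → Bool) → ℝ) :
    2 * ∑ x, F x = ∑ x, (F (Function.update x i false) + F (Function.update x i true)) := by
  have hflip : Function.Involutive fun x : W → Bool => Function.update x i (!x i) :=
    fun x => by simp
  calc 2 * ∑ x, F x = ∑ x, (F x + F (Function.update x i (!x i))) := by
        rw [Finset.sum_add_distrib, two_mul]
        exact congrArg _ (Equiv.sum_comp hflip.toPerm F).symm
    _ = _ := Finset.sum_congr rfl fun x _ => by
        nth_rewrite 1 [← Function.update_eq_self i x]
        cases x i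
        · rfl
        · exact add_comm _ _

theorem WireGate.sum_normSq_act (g : WireGate W) (ψ : StateVec W) :
    ∑ x, Complex.normSq (g.act ψ x) = ∑ x, Complex.normSq (ψ x) := by
  cases g with
  | H i =>
    have parallelogram (a b : ℂ) : Complex.normSq ((a + 1 * b) / (Real.sqrt 2 : ℂ)) +
        Complex.normSq ((a + -1 * b) / (Real.sqrt 2 : ℂ)) =
          Complex.normSq a + Complex.normSq b := by
      rw [one_mul, neg_one_mul, ← sub_eq_add_neg, map_div₀, map_div₀, normSq_sqrt_two,
        Complex.normSq_add, Complex.normSq_sub]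
      ring
    refine mul_left_cancel₀ (two_ne_zero' ℝ) ?_
    rw [two_mul_sum_eq_sum_update i, two_mul_sum_eq_sum_update i]
    simp only [act, Function.update_self, Function.update_idem, Bool.false_eq_true, if_false,
      if_true, parallelogram]
  | T i =>
    refine Finset.sum_congr rfl fun x _ => ?_
    simp only [act, map_mul, apply_ite Complex.normSq, normSq_tPhase, map_one, ite_self, one_mul]
  | CNOT c t h => exact Equiv.sum_comp (cnot_involutive h).toPerm fun x => Complex.normSq (ψ x)

theorem sum_normSq_evolve (L : List (WireGate W)) (ψ : StateVec W) :
    ∑ x, Complex.normSq (evolve L ψ x) = ∑ x, Complex.normSq (ψ x) := by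
  induction L generalizing ψ with
  | nil => rfl
  | cons g L ih => rw [evolve_cons, ih, WireGate.sum_normSq_act]

/-- The probability of observing `v` after running `L` on `|u⟩`. -/
noncomputable def transProb (L : List (WireGate W)) (u v : W → Bool) : ℝ :=
  Complex.normSq (evolve L (ket u) v)

theorem transProb_nonneg (L : List (WireGate W)) (u v : W → Bool) : 0 ≤ transProb L u v :=
  Complex.normSq_nonneg _

theorem sum_transProb (L : List (WireGate W)) (u : W → Bool) : ∑ v, transProb L u v = 1 := by
  simp_rw [transProb, sum_normSq_evolve, Pi.single_apply, apply_ite Complex.normSq, map_one,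
    map_zero, Finset.sum_ite_eq', Finset.mem_univ, if_true]

end Evolution

/-! ### Input wires and effects -/

section Effect

variable {ι κ W : Type*}

/-- The basis state in which the input wires carry `s` and all other wires carry zero. -/
noncomputable def initBits (inp : ι ↪ W) (s : ι → Bool) : W → Bool :=
  Function.extend inp s fun _ => false

@[simp] theorem initBits_apply (inp : ι ↪ W) (s : ι → Bool) (i : ι) :
    initBits inp s (inp i) = s i := inp.injective.extend_apply _ _ i

theorem initBits_of_notMem (inp : ι ↪ W) (s : ι → Bool) {w : W} (hw : ∀ i, inp i ≠ w) :
    initBits inp s w = false :=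
  Function.extend_apply' _ _ _ fun ⟨i, hi⟩ => hw i hi

theorem eq_initBits_iff (inp : ι ↪ W) (s : ι → Bool) (u : W → Bool) :
    u = initBits inp s ↔ u ∘ inp = s ∧ ∀ w, (∀ i, inp i ≠ w) → u w = false := by
  refine ⟨?_, fun ⟨hs, h0⟩ => ?_⟩
  · rintro rfl
    exact ⟨funext (initBits_apply inp s), fun w hw => initBits_of_notMem inp s hw⟩
  · funext w
    by_cases h : ∃ i, inp i = w
    · obtain ⟨i, rfl⟩ := h
      rw [initBits_apply, ← hs, Function.comp_apply]
    · have hw : ∀ i, inp i ≠ w := fun i hi => h ⟨i, hi⟩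
      rw [h0 w hw, initBits_of_notMem inp s hw]

theorem initBits_trans_equiv_comp {W' : Type*} (inp : ι ↪ W) (e : W ≃ W') (s : ι → Bool) :
    initBits (inp.trans e.toEmbedding) s ∘ e = initBits inp s := by
  refine (eq_initBits_iff _ _ _).2 ⟨?_, fun w hw => ?_⟩
  · funext i
    exact initBits_apply (inp.trans e.toEmbedding) s i
  · exact initBits_of_notMem _ s fun i => e.injective.ne (hw i)

variable [Fintype W] [DecidableEq W]

/-- The isometry from the state space of the inputs to that of all wires which adds the
zero-initialized wires and then runs the gates. -/
noncomputable def runMatrix (L : List (WireGate W)) (inp : ι ↪ W) :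
    Matrix (W → Bool) (ι → Bool) ℂ :=
  Matrix.of fun v s => evolve L (ket (initBits inp s)) v

/-- The projection onto the basis states that carry `y` on the output wires. -/
def outputProj [Fintype κ] (out : κ ↪ W) (y : κ → Bool) : Matrix (W → Bool) (W → Bool) ℂ :=
  Matrix.diagonal fun v => if v ∘ out = y then 1 else 0

/-- The POVM element of the outcome `y`, pulled back to the input state space: on the input state
`ρ`, the outcome `y` has probability `tr (ρ * effect L inp out y)`. -/
noncomputable def effect [Fintype κ] (L : List (WireGate W)) (inp : ι ↪ W) (out : κ ↪ W)
    (y : κ → Bool) : Matrix (ι → Bool) (ι → Bool) ℂ :=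
  (runMatrix L inp)ᴴ * outputProj out y * runMatrix L inp

variable [Fintype κ]

theorem effect_apply (L : List (WireGate W)) (inp : ι ↪ W) (out : κ ↪ W) (y : κ → Bool)
    (s t : ι → Bool) :
    effect L inp out y s t = ∑ v, if v ∘ out = y then
      star (evolve L (ket (initBits inp s)) v) * evolve L (ket (initBits inp t)) v else 0 := by
  rw [effect, Matrix.mul_apply]
  simp only [outputProj, Matrix.mul_diagonal, Matrix.conjTranspose_apply, runMatrix,
    Matrix.of_apply, mul_ite, mul_one, mul_zero, ite_mul, zero_mul]

theorem effect_self (L : List (WireGate W)) (inp : ι ↪ W) (out : κ ↪ W) (y : κ → Bool)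
    (s : ι → Bool) :
    effect L inp out y s s =
      ((∑ v, if v ∘ out = y then transProb L (initBits inp s) v else 0 : ℝ) : ℂ) := by
  rw [effect_apply]
  push_cast
  refine Finset.sum_congr rfl fun v _ => ?_
  rw [Complex.star_def, ← Complex.normSq_eq_conj_mul_self, ← transProb]
  split_ifs <;> simp

theorem effect_map_equiv {W' : Type*} [Fintype W'] [DecidableEq W'] (e : W ≃ W')
    (L : List (WireGate W)) (inp : ι ↪ W) (out : κ ↪ W) (y : κ → Bool) :
    effect (L.map (WireGate.map e.toEmbedding)) (inp.trans e.toEmbedding)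
      (out.trans e.toEmbedding) y = effect L inp out y := by
  ext s t
  simp only [effect_apply, evolve_map_equiv_ket, initBits_trans_equiv_comp]
  exact Fintype.sum_equiv (Equiv.arrowCongr e.symm (Equiv.refl Bool)) _ _ fun x => rfl

end Effect

/-! ### The semantics of circuits in terms of effects -/

section Circuit

variable {n m w : ℕ}

/-- A gate on `w` qubits as a gate on the wires `Fin w`. -/
def Gate.toWireGate : Gate w → WireGate (Fin w)
  | .H i => .H i
  | .T i => .T i
  | .CNOT c t h => .CNOT c t h

/-- The converse of `Gate.toWireGate`. -/
def WireGate.toGate : WireGate (Fin w) → Gate w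
  | .H i => .H i
  | .T i => .T i
  | .CNOT c t h => .CNOT c t h

theorem WireGate.toWireGate_toGate (g : WireGate (Fin w)) : g.toGate.toWireGate = g := by
  cases g <;> rfl

theorem Gate.toMatrix_H_mulVec (i : Fin w) (ψ : StateVec (Fin w)) :
    (Gate.H i).toMatrix *ᵥ ψ = (WireGate.H i).act ψ := by
  funext x
  simp only [toMatrix, WireGate.act, Matrix.mulVec, dotProduct, Matrix.of_apply]
  rw [Fintype.sum_eq_add (Function.update x i false) (Function.update x i true)]
  · have h (b : Bool) : ∀ j, j ≠ i → x j = Function.update x i b j :=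
      fun j hj => (Function.update_of_ne hj _ _).symm
    rw [if_pos (h false), if_pos (h true)]
    cases x i <;> simp <;> ring
  · exact fun h => by simpa using congrFun h i
  · rintro y ⟨h0, h1⟩
    rw [if_neg, zero_mul]
    intro h
    have hy : y = Function.update x i (y i) :=
      Function.eq_update_iff.2 ⟨rfl, fun j hj => (h j hj).symm⟩
    cases hb : y i with
    | false => exact h0 (hb ▸ hy)
    | true => exact h1 (hb ▸ hy)

theorem Gate.toMatrix_mulVec (g : Gate w) (ψ : StateVec (Fin w)) :
    g.toMatrix *ᵥ ψ = g.toWireGate.act ψ := by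
  cases g with
  | H i => exact toMatrix_H_mulVec i ψ
  | T i =>
    funext x
    simp only [toMatrix, toWireGate, WireGate.act, Matrix.mulVec_diagonal, tPhase]
  | CNOT c t h =>
    funext x
    have hinv (y : Bits w) : x = Function.update y t (Bool.xor (y t) (y c)) ↔
        Function.update x t (Bool.xor (x t) (x c)) = y :=
      eq_comm.trans (cnot_involutive h).eq_iff |>.trans eq_comm
    simp [toMatrix, toWireGate, WireGate.act, Matrix.mulVec, dotProduct, hinv]

namespace QCircuit

/-- The gates of a circuit, as gates on the wires `Fin C.width`. -/
def wireGates (C : QCircuit n m) : List (WireGate (Fin C.width)) := C.gates.map Gate.toWireGate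

theorem unitaryPart_mulVec (C : QCircuit n m) (ψ : StateVec (Fin C.width)) :
    C.unitaryPart *ᵥ ψ = evolve C.wireGates ψ := by
  have h (L : List (Gate C.width)) (M : Matrix (Bits C.width) (Bits C.width) ℂ) :
      L.foldl (fun U g => g.toMatrix * U) M *ᵥ ψ = evolve (L.map Gate.toWireGate) (M *ᵥ ψ) := by
    induction L generalizing M with
    | nil => rfl
    | cons g L ih =>
      rw [List.foldl_cons, ih, List.map_cons, evolve_cons, ← Matrix.mulVec_mulVec,
        Gate.toMatrix_mulVec]
  rw [unitaryPart, h, Matrix.one_mulVec, wireGates]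

theorem initState_eq (C : QCircuit n m) (ρ : Matrix (Bits n) (Bits n) ℂ) :
    C.initState ρ = runMatrix [] C.inp * ρ * (runMatrix [] C.inp)ᴴ := by
  ext u v
  have hrun (u : Bits C.width) (s : Bits n) : runMatrix [] C.inp u s =
      if s = u ∘ C.inp then if ∀ j, (∀ i, C.inp i ≠ j) → u j = false then 1 else 0 else 0 := by
    simp only [runMatrix, Matrix.of_apply, evolve_nil, Pi.single_apply, eq_initBits_iff, ite_and,
      eq_comm]
  simp only [initState, Matrix.of_apply, Matrix.mul_apply, Matrix.conjTranspose_apply, hrun,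
    ite_mul, zero_mul, apply_ite star, star_zero, star_one, mul_ite, mul_zero, mul_one, one_mul,
    Finset.sum_ite_eq', Finset.mem_univ, if_true, forall_and, ite_and]
  split_ifs <;> rfl

theorem unitaryPart_mul_runMatrix (C : QCircuit n m) :
    C.unitaryPart * runMatrix [] C.inp = runMatrix C.wireGates C.inp := by
  ext v s
  exact congrFun (C.unitaryPart_mulVec (ket (initBits C.inp s))) v

theorem traceOut_self (C : QCircuit n m) (σ : Matrix (Bits C.width) (Bits C.width) ℂ)
    (y : Bits m) : C.traceOut σ y y = (outputProj C.out y * σ).trace := by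
  simp only [traceOut, Matrix.of_apply, outputProj, Matrix.trace, Matrix.diag_apply,
    Matrix.diagonal_mul, ite_mul, one_mul, zero_mul]
  refine Finset.sum_congr rfl fun x _ => ?_
  rw [Finset.sum_eq_single x]
  · simp [funext_iff]
  · refine fun z _ hz => if_neg fun ⟨hx, hzy, hrest⟩ => hz (funext fun j => ?_)
    by_cases hj : ∃ i, C.out i = j
    · obtain ⟨i, rfl⟩ := hj
      rw [hx, hzy]
    · exact (hrest j fun i hi => hj ⟨i, hi⟩).symm
  · simp

theorem channel_self (C : QCircuit n m) (ρ : Matrix (Bits n) (Bits n) ℂ) (y : Bits m) :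
    C.channel ρ y y = (ρ * effect C.wireGates C.inp C.out y).trace := by
  set R := runMatrix C.wireGates C.inp with hR
  have hstate : C.unitaryPart * C.initState ρ * C.unitaryPartᴴ = R * ρ * Rᴴ := by
    simp only [initState_eq, hR, ← unitaryPart_mul_runMatrix, Matrix.conjTranspose_mul,
      Matrix.mul_assoc]
  calc C.channel ρ y y = (outputProj C.out y * (R * ρ * Rᴴ)).trace := by
        rw [channel, traceOut_self, hstate]
    _ = (outputProj C.out y * R * (ρ * Rᴴ)).trace := by simp only [Matrix.mul_assoc]
    _ = (ρ * effect C.wireGates C.inp C.out y).trace := by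
        rw [Matrix.trace_mul_comm, effect, ← hR]
        simp only [Matrix.mul_assoc]

theorem prob_eq (C : QCircuit n m) (x : Bits n) (y : Bits m) :
    C.prob x y =
      ∑ v, if v ∘ C.out = y then transProb C.wireGates (initBits C.inp x) v else 0 := by
  rw [prob, channel_self, Matrix.trace_single_mul, one_smul, effect_self, Complex.ofReal_re]

theorem prob_nonneg (C : QCircuit n m) (x : Bits n) (y : Bits m) : 0 ≤ C.prob x y := by
  rw [prob_eq]
  exact Finset.sum_nonneg fun v _ => ite_nonneg (transProb_nonneg _ _ _) le_rfl

theorem sum_prob (C : QCircuit n m) (x : Bits n) : ∑ y, C.prob x y = 1 := by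
  simp_rw [prob_eq]
  rw [Finset.sum_comm]
  simp_rw [Finset.sum_ite_eq, Finset.mem_univ, if_true, sum_transProb]

theorem length_wireGates_le_size (C : QCircuit n m) : C.wireGates.length ≤ C.size := by
  rw [wireGates, List.length_map, size]
  lia

theorem width_le_size (C : QCircuit n m) : C.width ≤ C.size := Nat.le_add_left _ _

theorem inputs_le_size (C : QCircuit n m) : n ≤ C.size := by
  simpa using (Fintype.card_le_of_embedding C.inp).trans (by simpa using C.width_le_size)

theorem outputs_le_size (C : QCircuit n m) : m ≤ C.size := by
  simpa using (Fintype.card_le_of_embedding C.out).trans (by simpa using C.width_le_size)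

end QCircuit

variable {W : Type*} [Fintype W]

/-- The circuit with gates `L` on the wires `W`, which get numbered arbitrarily. -/
noncomputable def circuitOf (L : List (WireGate W)) (inp : Fin n ↪ W) (out : Fin m ↪ W) :
    QCircuit n m where
  width := Fintype.card W
  gates := L.map fun g => (g.map (Fintype.equivFin W).toEmbedding).toGate
  inp := inp.trans (Fintype.equivFin W).toEmbedding
  out := out.trans (Fintype.equivFin W).toEmbedding

theorem size_circuitOf (L : List (WireGate W)) (inp : Fin n ↪ W) (out : Fin m ↪ W) :
    (circuitOf L inp out).size = L.length + Fintype.card W + Fintype.card W := by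
  rw [QCircuit.size, circuitOf, List.length_map]

variable [DecidableEq W]

theorem channel_circuitOf_self (L : List (WireGate W)) (inp : Fin n ↪ W) (out : Fin m ↪ W)
    (ρ : Matrix (Bits n) (Bits n) ℂ) (y : Bits m) :
    (circuitOf L inp out).channel ρ y y = (ρ * effect L inp out y).trace := by
  have hL : (circuitOf L inp out).wireGates =
      L.map (WireGate.map (Fintype.equivFin W).toEmbedding) := by
    simp [QCircuit.wireGates, circuitOf, WireGate.toWireGate_toGate]
  rw [QCircuit.channel_self, hL, ← effect_map_equiv (Fintype.equivFin W)]
  rfl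

theorem prob_circuitOf (L : List (WireGate W)) (inp : Fin n ↪ W) (out : Fin m ↪ W)
    (x : Bits n) (y : Bits m) :
    (circuitOf L inp out).prob x y =
      ∑ v, if v ∘ out = y then transProb L (initBits inp x) v else 0 := by
  rw [QCircuit.prob, channel_circuitOf_self, Matrix.trace_single_mul, one_smul, effect_self,
    Complex.ofReal_re]

end Circuit

/-! ### Reversible classical computation -/

section Reversible

variable {W : Type*} [DecidableEq W]

/-- The map `f` on basis states is computed without ancillas by at most `B` gates: they move the
amplitude of every `v` to `f v`. -/
def Implementable (B : ℕ) (f : (W → Bool) → W → Bool) : Prop :=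
  ∃ L : List (WireGate W), L.length ≤ B ∧ ∀ ψ v, evolve L ψ (f v) = ψ v

theorem Implementable.id : Implementable 0 (id : (W → Bool) → W → Bool) :=
  ⟨[], le_rfl, fun _ _ => rfl⟩

theorem Implementable.comp {B B' : ℕ} {f g : (W → Bool) → W → Bool}
    (hg : Implementable B' g) (hf : Implementable B f) : Implementable (B + B') (g ∘ f) := by
  obtain ⟨L, hL, hLf⟩ := hf
  obtain ⟨L', hL', hLg⟩ := hg
  refine ⟨L ++ L', by rw [List.length_append]; gcongr, fun ψ v => ?_⟩
  rw [evolve_append, Function.comp_apply, hLg, hLf]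

theorem Implementable.mono {B B' : ℕ} {f : (W → Bool) → W → Bool} (hf : Implementable B f)
    (hB : B ≤ B') : Implementable B' f :=
  let ⟨L, hL, hLf⟩ := hf
  ⟨L, hL.trans hB, hLf⟩

theorem bijective_of_evolve_eq [Finite W] {L : List (WireGate W)} {f : (W → Bool) → W → Bool}
    (hf : ∀ ψ v, evolve L ψ (f v) = ψ v) : Function.Bijective f := by
  cases nonempty_fintype W
  refine Finite.injective_iff_bijective.1 fun u v huv => ?_
  have h := (hf (ket u) u).symm.trans (huv ▸ hf (ket u) v)
  by_contra hne
  simp [Ne.symm hne] at h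

theorem evolve_ket_of_evolve_eq [Fintype W] {L : List (WireGate W)} {f : (W → Bool) → W → Bool}
    (hf : ∀ ψ v, evolve L ψ (f v) = ψ v) (u : W → Bool) : evolve L (ket u) = ket (f u) := by
  have hbij := bijective_of_evolve_eq hf
  funext v
  obtain ⟨w, rfl⟩ := hbij.surjective v
  simp only [hf, Pi.single_apply, hbij.injective.eq_iff]

/-- The addition of the bit `F v` to the wire `t`. -/
def xorOp (t : W) (F : (W → Bool) → Bool) (v : W → Bool) : W → Bool :=
  Function.update v t (Bool.xor (v t) (F v))

theorem implementable_cnot {c t : W} (h : c ≠ t) : Implementable 1 (xorOp t fun v => v c) :=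
  ⟨[.CNOT c t h], le_rfl, fun ψ v => congrArg ψ (cnot_involutive h v)⟩

theorem Implementable.xor {B B' : ℕ} {t : W} {F F' : (W → Bool) → Bool}
    (hF : Implementable B (xorOp t F)) (hF' : Implementable B' (xorOp t F'))
    (h : ∀ v b, F' (Function.update v t b) = F' v) :
    Implementable (B + B') (xorOp t fun v => Bool.xor (F v) (F' v)) := by
  convert hF'.comp hF using 1
  funext v
  simp [xorOp, h]

/-- The gates multiply the amplitude of each basis state `x` by `D x`. -/
def IsDiagonal (L : List (WireGate W)) (D : (W → Bool) → ℂ) : Prop :=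
  ∀ ψ x, evolve L ψ x = D x * ψ x

theorem IsDiagonal.append {L L' : List (WireGate W)} {D D' : (W → Bool) → ℂ}
    (h : IsDiagonal L D) (h' : IsDiagonal L' D') : IsDiagonal (L ++ L') (D * D') :=
  fun ψ x => by rw [evolve_append, h', h, Pi.mul_apply]; ring

theorem isDiagonal_replicate_T (k : ℕ) (i : W) :
    IsDiagonal (List.replicate k (.T i)) fun x => tPhase ^ (k * (x i).toNat) := by
  induction k with
  | zero => intro ψ x; simp
  | succ k ih =>
    intro ψ x
    rw [List.replicate_succ, evolve_cons, ih]
    cases hx : x i <;> simp [WireGate.act, hx, pow_succ, mul_assoc]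

theorem IsDiagonal.conj_cnot {L : List (WireGate W)} {D : (W → Bool) → ℂ} (h : IsDiagonal L D)
    {c t : W} (hct : c ≠ t) :
    IsDiagonal (.CNOT c t hct :: (L ++ [.CNOT c t hct])) (D ∘ xorOp t fun v => v c) := by
  intro ψ x
  have hinv := cnot_involutive hct x
  simp only [evolve_cons, evolve_append, evolve_nil, WireGate.act, Function.comp_apply, xorOp,
    h _ _]
  exact congrArg _ (congrArg ψ hinv)

/-- Since `4abc = a + b + c - (a ⊕ b) - (a ⊕ c) - (b ⊕ c) + (a ⊕ b ⊕ c)`, a doubly controlled sign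
is a product of eighth roots of unity that depend on parities only. -/
theorem tPhase_pow_parities (a b c : Bool) :
    tPhase ^ a.toNat * tPhase ^ b.toNat * tPhase ^ c.toNat *
        tPhase ^ (7 * (b ^^ a).toNat) * tPhase ^ (7 * (c ^^ a).toNat) *
        tPhase ^ (7 * (c ^^ b).toNat) * tPhase ^ (c ^^ a ^^ b).toNat =
      (-1) ^ (c && (a && b)).toNat := by
  have hmod : a.toNat + b.toNat + c.toNat + 7 * (b ^^ a).toNat + 7 * (c ^^ a).toNat +
      7 * (c ^^ b).toNat + (c ^^ a ^^ b).toNat = 4 * (c && (a && b)).toNat +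
        4 * (2 * ((b ^^ a).toNat + (c ^^ a).toNat + (c ^^ b).toNat)) := by
    decide +revert
  simp only [← pow_add]
  rw [hmod, pow_add, pow_mul, pow_mul tPhase 4, tPhase_pow_four, pow_mul (-1) 2, neg_one_sq,
    one_pow, mul_one]

theorem exists_isDiagonal_ccz {a b c : W} (hab : a ≠ b) (hac : a ≠ c) (hbc : b ≠ c) :
    ∃ L, L.length ≤ 35 ∧ IsDiagonal L fun x => (-1) ^ (x c && (x a && x b)).toNat := by
  have hT (i : W) := isDiagonal_replicate_T 1 i
  have hparity (i j : W) (h : i ≠ j) := (isDiagonal_replicate_T 7 j).conj_cnot h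
  have h := ((((((hT a).append (hT b)).append (hT c)).append (hparity a b hab)).append
    (hparity a c hac)).append (hparity b c hbc)).append (((hT c).conj_cnot hbc).conj_cnot hac)
  refine ⟨_, by simp, fun ψ x => (h ψ x).trans (congrArg (· * ψ x) ?_)⟩
  refine Eq.trans ?_ (tPhase_pow_parities (x a) (x b) (x c))
  simp [xorOp, Function.update_of_ne hbc]

theorem IsDiagonal.implementable_xorOp {L : List (WireGate W)} {t : W} {F : (W → Bool) → Bool}
    (h : IsDiagonal L fun x => (-1) ^ (x t && F x).toNat)
    (hF : ∀ v b, F (Function.update v t b) = F v) :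
    Implementable (L.length + 2) (xorOp t F) := by
  refine ⟨.H t :: (L ++ [.H t]), by simp, fun ψ v => ?_⟩
  have hsqrt : (Real.sqrt 2 : ℂ) ≠ 0 := by simp
  have hsq : (Real.sqrt 2 : ℂ) ^ 2 = 2 := by
    rw [← Complex.ofReal_pow, Real.sq_sqrt zero_le_two, Complex.ofReal_ofNat]
  have hv : ψ v = ψ (Function.update v t (v t)) := by rw [Function.update_eq_self]
  rw [hv]
  simp only [evolve_cons, evolve_append, evolve_nil, WireGate.act, xorOp, h _ _,
    Function.update_self, Function.update_idem, hF]
  cases v t <;> cases F v <;> simp <;> field_simp <;> rw [hsq] <;> ring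

theorem implementable_toffoli {a b t : W} (hab : a ≠ b) (hat : a ≠ t) (hbt : b ≠ t) :
    Implementable 37 (xorOp t fun v => v a && v b) := by
  obtain ⟨L, hL, hdiag⟩ := exists_isDiagonal_ccz hab hat hbt
  refine (hdiag.implementable_xorOp fun v x => ?_).mono (by lia)
  rw [Function.update_of_ne hat, Function.update_of_ne hbt]

end Reversible

section XorFamily

/-- The simultaneous addition of the bit `F p v` to the wire `e p`, for all `p`. -/
noncomputable def xorFamily {P W : Type*} (e : P ↪ W) (F : P → (W → Bool) → Bool) (v : W → Bool) :
    W → Bool :=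
  Function.extend e (fun p => Bool.xor (v (e p)) (F p v)) v

variable {P W : Type*} (e : P ↪ W) (F : P → (W → Bool) → Bool) (v : W → Bool)

theorem xorFamily_apply (p : P) : xorFamily e F v (e p) = Bool.xor (v (e p)) (F p v) :=
  e.injective.extend_apply _ _ _

theorem xorFamily_of_notMem {w : W} (hw : ∀ p, e p ≠ w) : xorFamily e F v w = v w :=
  Function.extend_apply' _ _ _ fun ⟨p, hp⟩ => hw p hp

variable [DecidableEq W] {e F}

theorem xorFamily_insert [DecidableEq P] {S : Finset P} {p : P} (hp : p ∉ S)
    (hF : ∀ q v b, F q (Function.update v (e p) b) = F q v) :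
    xorFamily e (fun q v => decide (q ∈ insert p S) && F q v) =
      xorFamily e (fun q v => decide (q ∈ S) && F q v) ∘ xorOp (e p) (F p) := by
  funext v w
  rw [Function.comp_apply]
  by_cases hw : ∃ q, e q = w
  · obtain ⟨q, rfl⟩ := hw
    rw [xorFamily_apply, xorFamily_apply]
    rcases eq_or_ne q p with rfl | hq
    · simp [xorOp, hp]
    · rw [xorOp, hF, Function.update_of_ne (e.injective.ne hq)]
      simp [hq]
  · have hw' : ∀ q, e q ≠ w := fun q hq => hw ⟨q, hq⟩
    rw [xorFamily_of_notMem e _ _ hw', xorFamily_of_notMem e _ _ hw', xorOp,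
      Function.update_of_ne (hw' p).symm]

theorem implementable_xorFamily [Fintype P] {B : ℕ} (hB : ∀ p, Implementable B (xorOp (e p) (F p)))
    (hF : ∀ p q v b, F q (Function.update v (e p) b) = F q v) :
    Implementable (Fintype.card P * B) (xorFamily e F) := by
  classical
  suffices h : ∀ S : Finset P,
      Implementable (S.card * B) (xorFamily e fun q v => decide (q ∈ S) && F q v) by
    simpa using h Finset.univ
  intro S
  induction S using Finset.induction_on with
  | empty =>
    convert Implementable.id (W := W) using 1
    · simp
    · funext v
      simp only [xorFamily, Finset.notMem_empty, decide_false, Bool.false_and, Bool.xor_false]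
      exact extend_comp_self e v
  | insert p S hp ih =>
    rw [xorFamily_insert hp (hF p), Finset.card_insert_of_notMem hp, add_mul, one_mul, add_comm]
    exact ih.comp (hB p)

end XorFamily

/-! ### Parallel runs of a circuit -/

section Parallel

/-- The wires of the `i`-th copy among `n` copies of the wires `V` and additional wires `R`. -/
def copyEmb {n : ℕ} (V R : Type*) (i : Fin n) : V ↪ (Fin n × V) ⊕ R :=
  (Function.Embedding.sectR i V).trans .inl

/-- The gates `L` on each of the `n` copies of the wires `V`. -/
def parallelGates {V : Type*} (n : ℕ) (R : Type*) (L : List (WireGate V)) :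
    List (WireGate ((Fin n × V) ⊕ R)) :=
  (List.finRange n).flatMap fun i => L.map (WireGate.map (copyEmb V R i))

theorem length_parallelGates {n : ℕ} {V R : Type*} (L : List (WireGate V)) :
    (parallelGates n R L).length = n * L.length := by
  simp [parallelGates, List.length_flatMap]

/-- The product of states `φ i` of the copies and a state `r` of the additional wires. -/
noncomputable def prodState {n : ℕ} {V R : Type*} (φ : Fin n → StateVec V) (r : StateVec R) :
    StateVec ((Fin n × V) ⊕ R) :=
  fun x => (∏ i, φ i (x ∘ copyEmb V R i)) * r (x ∘ Sum.inr)

variable {n : ℕ} {V R : Type*}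

theorem copyEmb_eq_copyEmb_iff {i j : Fin n} {s t : V} :
    copyEmb V R i s = copyEmb V R j t ↔ i = j ∧ s = t := by
  simp [copyEmb]

/-- Assignments of bits to all wires, as pairs of assignments to the copies and to the additional
wires. -/
def joinEquiv (n : ℕ) (V R : Type*) :
    (Fin n → V → Bool) × (R → Bool) ≃ ((Fin n × V) ⊕ R → Bool) where
  toFun p := Sum.elim (fun q => p.1 q.1 q.2) p.2
  invFun x := (fun i => x ∘ copyEmb V R i, x ∘ Sum.inr)
  left_inv _ := rfl
  right_inv x := by
    funext w
    rcases w with ⟨i, j⟩ | q <;> rfl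

theorem ket_eq_prodState [Fintype V] [Fintype R] (g : Fin n → V → Bool) (r : R → Bool) :
    ket (joinEquiv n V R (g, r)) = prodState (fun i => ket (g i)) (ket r) := by
  funext x
  obtain ⟨⟨g', r'⟩, rfl⟩ := (joinEquiv n V R).surjective x
  have hcopy (i : Fin n) : joinEquiv n V R (g', r') ∘ copyEmb V R i = g' i := rfl
  have hrest : joinEquiv n V R (g', r') ∘ Sum.inr = r' := rfl
  simp only [prodState, hcopy, hrest, Pi.single_apply, EmbeddingLike.apply_eq_iff_eq,
    Prod.mk.injEq, Finset.prod_ite_zero, Finset.prod_const_one, Finset.mem_univ, true_imp_iff,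
    funext_iff (f := g'), ite_and, ite_mul, one_mul, zero_mul]

theorem prodState_eq_mul (i : Fin n) (φ : Fin n → StateVec V) (r : StateVec R)
    (x : (Fin n × V) ⊕ R → Bool) :
    prodState φ r x = ((∏ j ∈ Finset.univ.erase i, φ j (x ∘ copyEmb V R j)) *
      r (x ∘ Sum.inr)) * φ i (x ∘ copyEmb V R i) := by
  rw [prodState, ← Finset.mul_prod_erase Finset.univ _ (Finset.mem_univ i)]
  ring

theorem extend_copyEmb_comp_of_ne {i j : Fin n} (hij : j ≠ i) (u : V → Bool)
    (x : (Fin n × V) ⊕ R → Bool) :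
    Function.extend (copyEmb V R i) u x ∘ copyEmb V R j = x ∘ copyEmb V R j :=
  funext fun _ => Function.extend_apply' _ _ _ fun ⟨_, h⟩ =>
    hij (copyEmb_eq_copyEmb_iff.1 h).1.symm

theorem extend_copyEmb_comp_inr (i : Fin n) (u : V → Bool) (x : (Fin n × V) ⊕ R → Bool) :
    Function.extend (copyEmb V R i) u x ∘ Sum.inr = x ∘ Sum.inr :=
  funext fun _ => Function.extend_apply' _ _ _ fun ⟨_, h⟩ => Sum.inl_ne_inr h

variable [DecidableEq V] [DecidableEq R]

theorem evolve_copy_prodState (L : List (WireGate V)) (i : Fin n) (φ : Fin n → StateVec V)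
    (r : StateVec R) :
    evolve (L.map (WireGate.map (copyEmb V R i))) (prodState φ r) =
      prodState (Function.update φ i (evolve L (φ i))) r := by
  funext x
  set rest := (∏ j ∈ Finset.univ.erase i, φ j (x ∘ copyEmb V R j)) * r (x ∘ Sum.inr)
  have hslice : (fun u => prodState φ r (Function.extend (copyEmb V R i) u x)) = rest • φ i := by
    funext u
    rw [prodState_eq_mul i, Function.extend_comp (copyEmb V R i).injective,
      extend_copyEmb_comp_inr, Finset.prod_congr rfl fun j hj => by
        rw [extend_copyEmb_comp_of_ne (Finset.ne_of_mem_erase hj)]]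
    rfl
  rw [evolve_map, hslice, evolve_smul, prodState_eq_mul i, Function.update_self,
    Finset.prod_congr rfl fun j hj => by
      rw [Function.update_of_ne (Finset.ne_of_mem_erase hj)]]
  rfl

theorem evolve_parallelGates (L : List (WireGate V)) (φ : Fin n → StateVec V) (r : StateVec R) :
    evolve (parallelGates n R L) (prodState φ r) = prodState (fun i => evolve L (φ i)) r := by
  have h (l : List (Fin n)) (hl : l.Nodup) (φ : Fin n → StateVec V) :
      evolve (l.flatMap fun i => L.map (WireGate.map (copyEmb V R i))) (prodState φ r) =
        prodState (fun i => if i ∈ l then evolve L (φ i) else φ i) r := by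
    induction l generalizing φ with
    | nil => simp
    | cons i l ih =>
      rw [List.nodup_cons] at hl
      rw [List.flatMap_cons, evolve_append, evolve_copy_prodState, ih hl.2]
      congr 1
      funext j
      rcases eq_or_ne j i with rfl | hj
      · simp [hl.1]
      · simp [hj]
  rw [parallelGates, h _ (List.nodup_finRange n)]
  simp

variable [Fintype V] [Fintype R]

theorem transProb_parallelGates (L : List (WireGate V)) (u g : Fin n → V → Bool)
    (r r' : R → Bool) :
    transProb (parallelGates n R L) (joinEquiv n V R (u, r)) (joinEquiv n V R (g, r')) =
      if r' = r then ∏ i, transProb L (u i) (g i) else 0 := by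
  rw [transProb, ket_eq_prodState, evolve_parallelGates, prodState, map_mul, map_prod]
  change (∏ i, transProb L (u i) (g i)) * Complex.normSq (ket r r') = _
  simp [Pi.single_apply, apply_ite Complex.normSq]

end Parallel

section ParallelCircuit

theorem transProb_append {W : Type*} [Fintype W] [DecidableEq W] {L L' : List (WireGate W)}
    {f : (W → Bool) → W → Bool} (hf : ∀ ψ v, evolve L' ψ (f v) = ψ v) (u v : W → Bool) :
    transProb (L ++ L') u (f v) = transProb L u v := by
  rw [transProb, evolve_append, hf, transProb]

theorem QCircuit.prod_prob {a b n : ℕ} (C : QCircuit a b) (k : Fin n → Bits a)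
    (z : Fin n → Bits b) :
    ∏ i, C.prob (k i) (z i) = ∑ g : Fin n → Bits C.width, if (fun i => g i ∘ C.out) = z then
      ∏ i, transProb C.wireGates (initBits C.inp (k i)) (g i) else 0 := by
  simp only [C.prob_eq, Fintype.prod_sum, Finset.prod_ite_zero, Finset.mem_univ, true_imp_iff,
    funext_iff (f := fun _ => _ ∘ C.out)]

/-- Independent runs of `C` on the inputs `k₁, …, k_n`, followed by the reversible classical
computation `f`, which turns the results `z` of the runs into the output `F z`. -/
theorem exists_parallel_circuit {a b n N M B : ℕ} (C : QCircuit a b) {R : Type*} [Fintype R]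
    [DecidableEq R] {f : ((Fin n × Fin C.width) ⊕ R → Bool) → (Fin n × Fin C.width) ⊕ R → Bool}
    (hf : Implementable B f) (inp : Fin N ↪ (Fin n × Fin C.width) ⊕ R)
    (out : Fin M ↪ (Fin n × Fin C.width) ⊕ R) :
    ∃ D : QCircuit N M, D.size ≤ n * C.size + B + 2 * (n * C.size + Fintype.card R) ∧
      ∀ (x : Bits N) (k : Fin n → Bits a) (r : R → Bool) (F : (Fin n → Bits b) → Bits M),
        initBits inp x = joinEquiv n (Fin C.width) R (fun i => initBits C.inp (k i), r) →
        (∀ g, f (joinEquiv n (Fin C.width) R (g, r)) ∘ out = F fun i => g i ∘ C.out) →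
        ∀ y, D.prob x y = ∑ z, if F z = y then ∏ i, C.prob (k i) (z i) else 0 := by
  obtain ⟨L, hL, hLf⟩ := hf
  refine ⟨circuitOf (parallelGates n R C.wireGates ++ L) inp out, ?_, fun x k r F hx hF y => ?_⟩
  · rw [size_circuitOf, List.length_append, length_parallelGates, Fintype.card_sum,
      Fintype.card_prod, Fintype.card_fin, Fintype.card_fin]
    have h₁ := Nat.mul_le_mul_left n C.length_wireGates_le_size
    have h₂ := Nat.mul_le_mul_left n C.width_le_size
    lia
  · calc (circuitOf (parallelGates n R C.wireGates ++ L) inp out).prob x y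
      _ = ∑ p, if f (joinEquiv n _ R p) ∘ out = y then
            transProb (parallelGates n R C.wireGates) (initBits inp x) (joinEquiv n _ R p)
          else 0 := by
        rw [prob_circuitOf, ← (bijective_of_evolve_eq hLf).sum_comp,
          ← Equiv.sum_comp (joinEquiv n (Fin C.width) R)]
        simp only [transProb_append hLf]
      _ = ∑ g : Fin n → Bits C.width, if (F fun i => g i ∘ C.out) = y then
            ∏ i, transProb C.wireGates (initBits C.inp (k i)) (g i) else 0 := by
        rw [Fintype.sum_prod_type]
        refine Finset.sum_congr rfl fun g _ => ?_
        simp only [hx, transProb_parallelGates]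
        rw [Finset.sum_eq_single r (fun r' _ hr' => by simp [hr']) (by simp), hF, if_pos rfl]
      _ = ∑ z, if F z = y then ∏ i, C.prob (k i) (z i) else 0 := by
        simp only [C.prod_prob, ← Finset.sum_filter (fun z => F z = y)]
        rw [Finset.sum_comm]
        simp [Finset.sum_ite_eq]

end ParallelCircuit

/-! ### Threshold tables and majority -/

section Counting

variable {r : ℕ}

/-- The number of ones among the first `s` of the bits `x`. -/
def countOnes (x : Fin r → Bool) (s : Fin (r + 1)) : ℕ := Fin.partialSum (fun i => (x i).toNat) s

theorem countOnes_zero (x : Fin r → Bool) : countOnes x 0 = 0 := Fin.partialSum_zero _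

theorem countOnes_succ (x : Fin r → Bool) (s : Fin r) :
    countOnes x s.succ = countOnes x s.castSucc + (x s).toNat := Fin.partialSum_succ _ _

theorem countOnes_last (x : Fin r → Bool) :
    countOnes x (Fin.last r) = (Finset.univ.filter fun i => x i = true).card := by
  rw [Finset.card_filter, countOnes, Fin.partialSum, Fin.val_last, List.take_of_length_le (by simp),
    List.sum_ofFn]
  exact Finset.sum_congr rfl fun i _ => by cases x i <;> rfl

theorem decide_lt_add_toNat {m : ℕ} (j : Fin (m + 1)) (c : ℕ) (x : Bool) :
    decide ((j : ℕ) < c + x.toNat) =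
      Bool.xor (decide ((j : ℕ) < c)) (Bool.xor
        (x && Fin.cases true (fun i : Fin m => decide ((i : ℕ) < c)) j)
        (x && decide ((j : ℕ) < c))) := by
  induction j using Fin.cases <;> cases x <;> grind

variable {P W : Type*} (b : Fin r → P → W) (T : Fin (r + 1) × Fin (r + 1) × P ↪ W)

/-- The row of the threshold table for the first `s` bits. The wire `T (s, j, p)` is to indicate
whether more than `j` of the first `s` bits at position `p` are ones. -/
def tableRow (s : Fin (r + 1)) : Fin (r + 1) × P ↪ W := (Function.Embedding.sectR s _).trans T

/-- The entry of the next row of the threshold table, from the row `s` and the bit `s`. -/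
def nextEntry (s : Fin r) (q : Fin (r + 1) × P) (v : W → Bool) : Bool :=
  Bool.xor (v (T (s.castSucc, q))) (Bool.xor
    (v (b s q.2) && Fin.cases true (fun i : Fin r => v (T (s.castSucc, i.castSucc, q.2))) q.1)
    (v (b s q.2) && v (T (s.castSucc, q))))

variable {b T} [DecidableEq W]

theorem nextEntry_update (hbT : ∀ i p a, b i p ≠ T a) (s : Fin r) (q q' : Fin (r + 1) × P)
    (v : W → Bool) (c : Bool) :
    nextEntry b T s q' (Function.update v (tableRow T s.succ q) c) = nextEntry b T s q' v := by
  have hT (a) : T (s.castSucc, a) ≠ tableRow T s.succ q := fun h =>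
    s.castSucc_lt_succ.ne (congrArg Prod.fst (T.injective h))
  have hb : b s q'.2 ≠ tableRow T s.succ q := hbT _ _ _
  simp only [nextEntry, Function.update_of_ne (hT _), Function.update_of_ne hb]

theorem implementable_nextEntry (hbT : ∀ i p a, b i p ≠ T a) (s : Fin r)
    (q : Fin (r + 1) × P) :
    Implementable 75 (xorOp (tableRow T s.succ q) (nextEntry b T s q)) := by
  have hT (a) : T (s.castSucc, a) ≠ tableRow T s.succ q := fun h =>
    s.castSucc_lt_succ.ne (congrArg Prod.fst (T.injective h))
  have hb : b s q.2 ≠ tableRow T s.succ q := hbT _ _ _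
  have hprev : Implementable 37 (xorOp (tableRow T s.succ q) fun v =>
      v (b s q.2) &&
        Fin.cases true (fun i : Fin r => v (T (s.castSucc, i.castSucc, q.2))) q.1) := by
    obtain ⟨j, p⟩ := q
    induction j using Fin.cases with
    | zero => simpa using (implementable_cnot hb).mono (by norm_num : 1 ≤ 37)
    | succ i => exact implementable_toffoli (hbT _ _ _) hb (hT _)
  refine (implementable_cnot (hT q)).xor
    (hprev.xor (implementable_toffoli (hbT _ _ _) hb (hT q)) fun v c => ?_) fun v c => ?_
  · simp only [Function.update_of_ne (hT _), Function.update_of_ne hb]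
  · simp only [Function.update_of_ne (hT _), Function.update_of_ne hb]

variable [Fintype P]

theorem exists_implementable_table (hbT : ∀ i p a, b i p ≠ T a) (k : Fin (r + 1)) :
    ∃ f, Implementable (k * ((r + 1) * Fintype.card P * 75)) f ∧
      ∀ v, (∀ a, v (T a) = false) → (∀ i p, f v (b i p) = v (b i p)) ∧
        ∀ s j p, f v (T (s, j, p)) =
          decide (s ≤ k ∧ (j : ℕ) < countOnes (fun i => v (b i p)) s) := by
  induction k using Fin.induction with
  | zero =>
    refine ⟨id, by simpa using Implementable.id, fun v hv => ⟨fun _ _ => rfl, fun s j p => ?_⟩⟩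
    rw [id, hv, eq_comm, decide_eq_false_iff_not]
    rintro ⟨hs, hj⟩
    rw [Fin.le_zero_iff.1 hs, countOnes_zero] at hj
    exact Nat.not_lt_zero _ hj
  | succ k ih =>
    obtain ⟨f, hf, hfv⟩ := ih
    have hrow : Implementable ((r + 1) * Fintype.card P * 75)
        (xorFamily (tableRow T k.succ) (nextEntry b T k)) := by
      simpa using implementable_xorFamily (implementable_nextEntry hbT k) (nextEntry_update hbT k)
    refine ⟨xorFamily (tableRow T k.succ) (nextEntry b T k) ∘ f, ?_, fun v hv => ?_⟩
    · rw [Fin.val_succ, add_mul, one_mul]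
      exact hrow.comp hf
    obtain ⟨hb, hT⟩ := hfv v hv
    refine ⟨fun i p => ?_, fun s j p => ?_⟩
    · have hrow_ne (q) : tableRow T k.succ q ≠ b i p := (hbT i p _).symm
      rw [Function.comp_apply, xorFamily_of_notMem (tableRow T k.succ) _ _ hrow_ne, hb]
    rw [Function.comp_apply]
    rcases eq_or_ne s k.succ with rfl | hs
    · change xorFamily (tableRow T k.succ) (nextEntry b T k) (f v) (tableRow T k.succ (j, p)) = _
      have hzero : f v (tableRow T k.succ (j, p)) = false :=
        (hT _ _ _).trans (decide_eq_false fun h => h.1.not_gt k.castSucc_lt_succ)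
      simp [xorFamily_apply, hzero, nextEntry, hT, hb, countOnes_succ, decide_lt_add_toNat]
    · have hrow_ne (q) : tableRow T k.succ q ≠ T (s, j, p) := fun h =>
        hs (congrArg Prod.fst (T.injective h)).symm
      rw [xorFamily_of_notMem (tableRow T k.succ) _ _ hrow_ne, hT]
      have hle : s ≤ k.castSucc ↔ s ≤ k.succ := by
        rw [Fin.le_castSucc_iff, lt_iff_le_and_ne, and_iff_left hs]
      simp only [hle]

theorem exists_implementable_majority (hbT : ∀ i p a, b i p ≠ T a) :
    ∃ f, Implementable (r * ((r + 1) * Fintype.card P * 75)) f ∧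
      ∀ v, (∀ a, v (T a) = false) → ∀ p,
        f v (T (Fin.last r, ⟨r / 2, Nat.lt_succ_of_le (Nat.div_le_self r 2)⟩, p)) =
          decide (r < 2 * (Finset.univ.filter fun i => v (b i p) = true).card) := by
  obtain ⟨f, hf, hfv⟩ := exists_implementable_table hbT (Fin.last r)
  refine ⟨f, hf, fun v hv p => ?_⟩
  rw [(hfv v hv).2, decide_eq_decide, countOnes_last, and_iff_right le_rfl]
  lia

end Counting

/-! ### The circuits of the scheme -/

section Wiring

variable {V W : Type*} {n r a b : ℕ}

/-- The input `k₁ || … || k_r`, where `k_i` goes to the `i`-th copy of the wires `V`. -/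
def blockInp (r : ℕ) (inp : Fin n ↪ V) : Fin (r * n) ↪ Fin r × V :=
  finProdFinEquiv.symm.toEmbedding.trans ((Function.Embedding.refl (Fin r)).prodMap inp)

/-- The input `x || y`, where `x` and `y` go to disjoint sets of wires. -/
def appendInp (e₁ : Fin a ↪ V) (e₂ : Fin b ↪ W) : Fin (a + b) ↪ V ⊕ W :=
  finSumFinEquiv.symm.toEmbedding.trans (e₁.sumMap e₂)

theorem initBits_refl (x : V → Bool) : initBits (Function.Embedding.refl V) x = x :=
  funext fun i => initBits_apply (Function.Embedding.refl V) x i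

theorem initBits_trans_inl (inp : Fin n ↪ V) (x : Bits n) :
    initBits (inp.trans (Function.Embedding.inl : V ↪ V ⊕ W)) x =
      Sum.elim (initBits inp x) fun _ => false := by
  symm
  refine (eq_initBits_iff _ _ _).2 ⟨funext fun i => initBits_apply inp x i, ?_⟩
  rintro (w | w) hw
  · exact initBits_of_notMem _ _ fun i hi => hw i (congrArg Sum.inl hi)
  · rfl

theorem initBits_blockInp (inp : Fin n ↪ V) (k : Bits (r * n)) :
    initBits (blockInp r inp) k = fun q => initBits inp (block k q.1) q.2 := by
  symm
  refine (eq_initBits_iff _ _ _).2 ⟨funext fun t => ?_, fun w hw => ?_⟩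
  · obtain ⟨⟨i, j⟩, rfl⟩ := finProdFinEquiv.surjective t
    simp [blockInp, block]
  · refine initBits_of_notMem _ _ fun j hj => hw (finProdFinEquiv (w.1, j)) ?_
    simp [blockInp, hj]

theorem initBits_appendInp (e₁ : Fin a ↪ V) (e₂ : Fin b ↪ W) (x : Bits a) (y : Bits b) :
    initBits (appendInp e₁ e₂) (Fin.append x y) = Sum.elim (initBits e₁ x) (initBits e₂ y) := by
  symm
  refine (eq_initBits_iff _ _ _).2 ⟨funext fun t => ?_, ?_⟩
  · refine Fin.addCases (fun i => ?_) (fun i => ?_) t <;> simp [appendInp]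
  · rintro (w | w) hw
    · refine initBits_of_notMem _ _ fun i hi => hw (Fin.castAdd b i) ?_
      simp [appendInp, hi]
    · refine initBits_of_notMem _ _ fun i hi => hw (Fin.natAdd a i) ?_
      simp [appendInp, hi]

end Wiring

section Scheme

/-- The circuit that outputs a uniformly random bit. -/
def coinCircuit : QCircuit 0 1 where
  width := 1
  gates := [.H 0]
  inp := ⟨Fin.elim0, fun i => i.elim0⟩
  out := Function.Embedding.refl _

theorem coinCircuit_prob (x : Bits 0) (y : Bits 1) : coinCircuit.prob x y = 1 / 2 := by
  have hzero : initBits coinCircuit.inp x = fun _ => false :=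
    funext fun w => initBits_of_notMem _ _ fun i => i.elim0
  have hupdate (c : Bool) : Function.update y (0 : Fin 1) c = fun _ => c :=
    funext fun j => by rw [Subsingleton.elim j 0, Function.update_self]
  have hne : (fun _ : Fin 1 => true) ≠ fun _ => false := fun h => by simpa using congrFun h 0
  have hamp : evolve coinCircuit.wireGates (ket fun _ => false) y = 1 / (Real.sqrt 2 : ℂ) := by
    change (WireGate.H (0 : Fin 1)).act (ket fun _ => false) y = _
    simp [WireGate.act, hupdate, hne]
  calc coinCircuit.prob x y
    _ = transProb coinCircuit.wireGates (initBits coinCircuit.inp x) y :=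
      (coinCircuit.prob_eq x y).trans <|
        (Finset.sum_eq_single_of_mem y (Finset.mem_univ y) fun _ _ hv => if_neg hv).trans
          (if_pos rfl)
    _ = 1 / 2 := by simp only [transProb, hzero, hamp, map_div₀, normSq_sqrt_two, map_one]

theorem exists_uniform_circuit (N : ℕ) :
    ∃ C : QCircuit 0 N, C.size ≤ 9 * N ∧ ∀ x y, C.prob x y = 1 / 2 ^ N := by
  obtain ⟨D, hD, hprob⟩ := exists_parallel_circuit (n := N) coinCircuit (R := Empty)
    Implementable.id ⟨Fin.elim0, fun i => i.elim0⟩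
    ((Function.Embedding.sectL (Fin N) (coinCircuit.out 0)).trans .inl)
  refine ⟨D, hD.trans ?_, fun x y => ?_⟩
  · rw [show coinCircuit.size = 3 from rfl, Fintype.card_empty]
    lia
  · rw [hprob x (fun _ => Fin.elim0) Empty.elim (fun z t => z t 0) ?_ fun _ => rfl]
    · have hz (z : Fin N → Bits 1) : (fun t => z t 0) = y ↔ z = fun t _ => y t :=
        ⟨fun h => funext fun t => funext fun j => by rw [Subsingleton.elim j 0, ← h],
          fun h => by rw [h]⟩
      simp [hz, coinCircuit_prob]
    · funext w
      rcases w with w | w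
      · exact (initBits_of_notMem _ _ fun i => i.elim0).trans
          (initBits_of_notMem _ _ fun i => i.elim0).symm
      · exact w.elim

theorem exists_enc_circuit (r : ℕ) {n l : ℕ} (C : QCircuit n l) :
    ∃ E : QCircuit (r * n + l) (r * l), E.size ≤ 4 * (r + 1) * C.size ∧
      ∀ k m c, E.prob (Fin.append k m) c = ∑ y : Fin r → Bits l,
        if (concat fun i => bxor m (y i)) = c then ∏ i, C.prob (block k i) (y i) else 0 := by
  let outs : Fin r × Fin l ↪ (Fin r × Fin C.width) ⊕ Fin l :=
    ((Function.Embedding.refl (Fin r)).prodMap C.out).trans .inl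
  have hadd := implementable_xorFamily (B := 1) (e := outs) (F := fun p v => v (Sum.inr p.2))
    (fun p => implementable_cnot Sum.inr_ne_inl)
    (fun p q v c => Function.update_of_ne Sum.inr_ne_inl _ _)
  obtain ⟨E, hE, hprob⟩ := exists_parallel_circuit C hadd
    (appendInp (blockInp r C.inp) (Function.Embedding.refl (Fin l)))
    (finProdFinEquiv.symm.toEmbedding.trans outs)
  refine ⟨E, hE.trans ?_, fun k m c => hprob _ (block k) m _ ?_ (fun g => ?_) c⟩
  · have := C.outputs_le_size
    have := Nat.mul_le_mul_left r C.outputs_le_size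
    simp only [Fintype.card_prod, Fintype.card_fin]
    lia
  · rw [initBits_appendInp, initBits_blockInp, initBits_refl]
    rfl
  · funext t
    exact (xorFamily_apply outs _ _ _).trans (Bool.xor_comm _ _)

theorem exists_dec_circuit (r : ℕ) {n l : ℕ} (C : QCircuit n l) :
    ∃ D : QCircuit (r * n + r * l) l, D.size ≤ 100 * (r + 1) ^ 2 * C.size ∧
      ∀ k c m, D.prob (Fin.append k c) m = ∑ y : Fin r → Bits l,
        if (maj fun i => bxor (block c i) (y i)) = m then
          ∏ i, C.prob (block k i) (y i) else 0 := by
  let R := (Fin r × Fin l) ⊕ (Fin (r + 1) × Fin (r + 1) × Fin l)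
  let cipher : Fin r × Fin l ↪ (Fin r × Fin C.width) ⊕ R :=
    Function.Embedding.inl.trans .inr
  let table : Fin (r + 1) × Fin (r + 1) × Fin l ↪ (Fin r × Fin C.width) ⊕ R :=
    Function.Embedding.inr.trans .inr
  have hne (q a) : cipher q ≠ table a := fun h => Sum.inl_ne_inr (Sum.inr_injective h)
  have hadd := implementable_xorFamily (B := 1) (e := cipher)
    (F := fun p v => v (Sum.inl (p.1, C.out p.2)))
    (fun p => implementable_cnot Sum.inl_ne_inr)
    (fun p q v c => Function.update_of_ne Sum.inl_ne_inr _ _)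
  obtain ⟨f, hf, hmaj⟩ := exists_implementable_majority (b := fun i p => cipher (i, p))
    (T := table) fun i p a => hne _ _
  obtain ⟨D, hD, hprob⟩ := exists_parallel_circuit C (hf.comp hadd)
    (appendInp (blockInp r C.inp) ((blockInp r (Function.Embedding.refl (Fin l))).trans .inl))
    (((Function.Embedding.sectR _ _).trans (Function.Embedding.sectR _ _)).trans table)
  refine ⟨D, hD.trans ?_, fun k c m => hprob _ (block k) (Sum.elim (fun q => block c q.1 q.2)
    fun _ => false) _ ?_ (fun g => ?_) m⟩
  · have h : l ≤ C.size := C.outputs_le_size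
    simp only [R, Fintype.card_sum, Fintype.card_prod, Fintype.card_fin]
    nlinarith [Nat.mul_le_mul_left (r ^ 2) h, Nat.mul_le_mul_left r h]
  · rw [initBits_appendInp, initBits_blockInp, initBits_trans_inl, initBits_blockInp]
    simp only [initBits_refl]
    rfl
  · funext t
    refine (hmaj _ (fun a => ?_) t).trans ?_
    · exact xorFamily_of_notMem cipher _ _ fun q => hne q a
    · simp only [xorFamily_apply]
      rfl

theorem IsQPT.of_size_le {ℓ a b : ℕ → ℕ} {G : ∀ n, QCircuit n (ℓ n)}
    {C : ∀ n, QCircuit (a n) (b n)} (hG : IsQPT G) (q : Polynomial ℕ)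
    (hC : ∀ n, (C n).size ≤ q.eval n * (G n).size) : IsQPT C := by
  obtain ⟨p, hp⟩ := hG
  refine ⟨q * p, fun n => (hC n).trans ?_⟩
  rw [Polynomial.eval_mul]
  gcongr
  exact hp n

theorem exists_scheme {ℓ : ℕ → ℕ} {G : ∀ n, QCircuit n (ℓ n)} (hG : IsQPT G) :
    ∃ S, RealizesConstruction G S ∧ IsQPT S.Gen ∧ IsQPT S.Enc ∧ IsQPT S.Dec := by
  choose gen hgen hgenProb using fun n : ℕ => exists_uniform_circuit (n * n)
  choose enc henc hencProb using fun n : ℕ => exists_enc_circuit n (G n)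
  choose dec hdec hdecProb using fun n : ℕ => exists_dec_circuit n (G n)
  refine ⟨⟨gen, enc, dec⟩, ⟨fun n k => hgenProb n _ k, hencProb, hdecProb⟩,
    ⟨9 * (.X * .X), fun n => ?_⟩, hG.of_size_le (4 * (.X + 1)) fun n => ?_,
    hG.of_size_le (100 * (.X + 1) ^ 2) fun n => ?_⟩
  · simpa using hgen n
  · simpa using henc n
  · simpa using hdec n

end Scheme

/-! ### Correctness -/

section Negligible

theorem negligible_pow {q : ℝ} (hq : |q| < 1) : Negligible fun n => q ^ n :=
  fun k => tendsto_pow_const_mul_const_pow_of_abs_lt_one k hq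

theorem Negligible.exists_forall_le {α : ℕ → Type*} [∀ n, Finite (α n)] {f : ∀ n, α n → ℝ}
    {ε : ℕ → ℝ} (hε : Negligible ε) (h : ∀ᶠ n in atTop, ∀ x, f n x ≤ ε n) :
    ∃ ε' : ℕ → ℝ, Negligible ε' ∧ ∀ n x, f n x ≤ ε' n := by
  have hbound (n : ℕ) : ∃ e, (∀ x, f n x ≤ e) ∧ ((∀ x, f n x ≤ ε n) → ε n = e) := by
    by_cases hn : ∀ x, f n x ≤ ε n
    · exact ⟨ε n, hn, fun _ => rfl⟩
    · obtain ⟨e, he⟩ := (Set.finite_range (f n)).bddAbove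
      exact ⟨e, fun x => he ⟨x, rfl⟩, fun h => absurd h hn⟩
  choose ε' hle heq using hbound
  exact ⟨ε', hε.congr' (h.mono heq), hle⟩

end Negligible

section Majority

variable {Ω : Type*} (A : Ω → Prop) [DecidablePred A]

theorem one_le_prod_of_two_mul_card_le {r : ℕ} (ω : Fin r → Ω)
    (h : 2 * (Finset.univ.filter fun i => A (ω i)).card ≤ r) :
    1 ≤ ∏ i, if A (ω i) then (1 / 2 : ℝ) else 2 := by
  have hcard := Finset.card_filter_add_card_filter_not (s := Finset.univ) fun i => A (ω i)
  rw [Finset.card_univ, Fintype.card_fin] at hcard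
  rw [Finset.prod_ite, Finset.prod_const, Finset.prod_const, one_div, inv_pow, ← div_eq_inv_mul,
    one_le_div (by positivity)]
  exact pow_le_pow_right₀ one_le_two (by lia)

variable [Fintype Ω] {w : Ω → ℝ}

/-- Chernoff's method: Markov's inequality for the product of the weights `1 / 2` (on `A`) and `2`
(off `A`). -/
theorem sum_prod_ite_majority_ge (hw : ∀ ω, 0 ≤ w ω) (hsum : ∑ ω, w ω = 1) (r : ℕ) :
    1 - (2 - 3 / 2 * ∑ ω, if A ω then w ω else 0) ^ r ≤
      ∑ ω : Fin r → Ω,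
        if r < 2 * (Finset.univ.filter fun i => A (ω i)).card then ∏ i, w (ω i) else 0 := by
  have htwo : (2 : ℝ) = ∑ ω, 2 * w ω := by rw [← Finset.mul_sum, hsum, mul_one]
  have hmean : 2 - 3 / 2 * (∑ ω, if A ω then w ω else 0) =
      ∑ ω, w ω * if A ω then (1 / 2 : ℝ) else 2 := by
    calc _ = ∑ ω, 2 * w ω - ∑ ω, 3 / 2 * if A ω then w ω else 0 := by
          rw [← htwo, Finset.mul_sum]
      _ = _ := by
        rw [← Finset.sum_sub_distrib]
        refine Finset.sum_congr rfl fun ω _ => ?_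
        split_ifs <;> ring
  have hone : ∑ ω : Fin r → Ω, ∏ i, w (ω i) = 1 := by rw [← Fintype.sum_pow, hsum, one_pow]
  rw [hmean, Fintype.sum_pow, sub_le_iff_le_add, ← Finset.sum_add_distrib]
  refine hone.ge.trans (Finset.sum_le_sum fun ω _ => ?_)
  have hprod : 0 ≤ ∏ i, w (ω i) := Finset.prod_nonneg fun i _ => hw _
  rw [Finset.prod_mul_distrib]
  split_ifs with h
  · exact le_add_of_nonneg_right
      (mul_nonneg hprod (Finset.prod_nonneg fun i _ => by split_ifs <;> norm_num))
  · rw [zero_add]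
    exact le_mul_of_one_le_right hprod (one_le_prod_of_two_mul_card_le A ω (not_lt.1 h))

end Majority

section Collision

variable {n l : ℕ}

/-- The probability that a random seed and two runs of `C` on it are `ω`. -/
noncomputable def trialProb (C : QCircuit n l) (ω : Bits n × Bits l × Bits l) : ℝ :=
  1 / 2 ^ n * (C.prob ω.1 ω.2.1 * C.prob ω.1 ω.2.2)

theorem trialProb_nonneg (C : QCircuit n l) (ω : Bits n × Bits l × Bits l) :
    0 ≤ trialProb C ω :=
  mul_nonneg (by positivity) (mul_nonneg (C.prob_nonneg _ _) (C.prob_nonneg _ _))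

theorem sum_trialProb (C : QCircuit n l) : ∑ ω, trialProb C ω = 1 := by
  simp only [Fintype.sum_prod_type, trialProb, ← Finset.mul_sum, C.sum_prob, mul_one]
  simp

/-- The probability that two runs on a random seed agree. -/
noncomputable def collisionProb (C : QCircuit n l) : ℝ :=
  ∑ ω, if ω.2.1 = ω.2.2 then trialProb C ω else 0

theorem collisionProb_eq (C : QCircuit n l) :
    collisionProb C = ∑ k, 1 / 2 ^ n * ∑ y, C.prob k y ^ 2 := by
  simp only [collisionProb, Fintype.sum_prod_type, trialProb, Finset.sum_ite_eq, Finset.mem_univ,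
    if_true, Finset.mul_sum, sq]

theorem collisionProb_le_one (C : QCircuit n l) : collisionProb C ≤ 1 := by
  rw [← sum_trialProb C, collisionProb]
  refine Finset.sum_le_sum fun ω _ => ?_
  split_ifs
  · exact le_rfl
  · exact trialProb_nonneg C ω

theorem pow_three_le_collisionProb (C : QCircuit n l) {K : Finset (Bits n)} {δ : ℝ} (hδ : 0 ≤ δ)
    (hK : δ ≤ (K.card : ℝ) / 2 ^ n) (h : ∀ k ∈ K, ∃ y, δ ≤ C.prob k y) :
    δ ^ 3 ≤ collisionProb C := by
  have hseed : ∀ k ∈ K, δ ^ 2 ≤ ∑ y, C.prob k y ^ 2 := fun k hk => by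
    obtain ⟨y, hy⟩ := h k hk
    exact (pow_le_pow_left₀ hδ hy 2).trans <|
      Finset.single_le_sum (f := fun y => C.prob k y ^ 2) (fun y _ => sq_nonneg _)
        (Finset.mem_univ y)
  calc δ ^ 3 = δ * δ ^ 2 := by ring
    _ ≤ (K.card : ℝ) / 2 ^ n * δ ^ 2 := by gcongr
    _ = ∑ k ∈ K, 1 / 2 ^ n * δ ^ 2 := by rw [Finset.sum_const, nsmul_eq_mul]; ring
    _ ≤ ∑ k ∈ K, 1 / 2 ^ n * ∑ y, C.prob k y ^ 2 :=
      Finset.sum_le_sum fun k hk => by gcongr; exact hseed k hk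
    _ ≤ collisionProb C := by
      rw [collisionProb_eq]
      exact Finset.sum_le_sum_of_subset_of_nonneg (Finset.subset_univ K) fun k _ _ =>
        by positivity

end Collision

section Scheme

/-- Strings of length `a * b` as families of `a` blocks of length `b`. -/
def blockEquiv (a b : ℕ) : Bits (a * b) ≃ (Fin a → Bits b) where
  toFun := block
  invFun := concat
  left_inv s := funext fun t => congrArg s (finProdFinEquiv.apply_symm_apply t)
  right_inv s := by funext i j; simp [concat, block]

theorem block_concat {a b : ℕ} (s : Fin a → Bits b) (i : Fin a) : block (concat s) i = s i :=
  congrFun ((blockEquiv a b).right_inv s) i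

theorem bxor_bxor_cancel_right {n : ℕ} (m y : Bits n) : bxor (bxor m y) y = m := by
  funext i
  simp [bxor]

variable {ℓ : ℕ → ℕ} {G : ∀ n, QCircuit n (ℓ n)}

theorem prod_trialProb (n : ℕ) (k : Bits (n * n)) (y y' : Fin n → Bits (ℓ n)) :
    ∏ i, trialProb (G n) (block k i, y i, y' i) =
      1 / 2 ^ (n * n) * (parallelProb G n k y * parallelProb G n k y') := by
  simp only [trialProb, parallelProb, Finset.prod_mul_distrib, Finset.prod_const,
    Finset.card_univ, Fintype.card_fin, one_div_pow, ← pow_mul]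

variable {S : EncScheme (fun n => n * n) ℓ (fun n => n * ℓ n)}

namespace RealizesConstruction

theorem sum_encProb_mul (hS : RealizesConstruction G S) (n : ℕ) (k : Bits (n * n))
    (m : Bits (ℓ n)) (f : Bits (n * ℓ n) → ℝ) :
    ∑ c, S.encProb n k m c * f c =
      ∑ y, parallelProb G n k y * f (concat fun i => bxor m (y i)) := by
  simp only [hS.enc, Finset.sum_mul, ite_mul, zero_mul]
  rw [Finset.sum_comm]
  simp

theorem correctProb_eq (hS : RealizesConstruction G S) (n : ℕ) (m : Bits (ℓ n)) :
    S.correctProb n m = ∑ ω : Fin n → Bits n × Bits (ℓ n) × Bits (ℓ n),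
      if (maj fun i => bxor (bxor m (ω i).2.1) (ω i).2.2) = m then
        ∏ i, trialProb (G n) (ω i) else 0 := by
  let e : Bits (n * n) × (Fin n → Bits (ℓ n)) × (Fin n → Bits (ℓ n)) ≃
      (Fin n → Bits n × Bits (ℓ n) × Bits (ℓ n)) :=
    ((blockEquiv n n).prodCongr (Equiv.arrowProdEquivProdArrow _ _ _).symm).trans
      (Equiv.arrowProdEquivProdArrow _ _ _).symm
  have he (k y y' i) : e (k, y, y') i = (block k i, y i, y' i) := rfl
  rw [← Equiv.sum_comp e, Fintype.sum_prod_type, EncScheme.correctProb]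
  refine Finset.sum_congr rfl fun k _ => ?_
  rw [hS.gen, hS.sum_encProb_mul, Fintype.sum_prod_type]
  simp only [hS.dec, block_concat, he, prod_trialProb, Finset.mul_sum, mul_ite, mul_zero]

theorem correctProb_ge (hS : RealizesConstruction G S) (n : ℕ) (m : Bits (ℓ n)) :
    1 - (2 - 3 / 2 * collisionProb (G n)) ^ n ≤ S.correctProb n m := by
  refine (sum_prod_ite_majority_ge (fun ω : Bits n × Bits (ℓ n) × Bits (ℓ n) => ω.2.1 = ω.2.2)
    (trialProb_nonneg (G n)) (sum_trialProb (G n)) n).trans ?_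
  rw [hS.correctProb_eq]
  refine Finset.sum_le_sum fun ω _ => ?_
  have hprod : 0 ≤ ∏ i, trialProb (G n) (ω i) :=
    Finset.prod_nonneg fun i _ => trialProb_nonneg _ _
  by_cases h : n < 2 * (Finset.univ.filter fun i => (ω i).2.1 = (ω i).2.2).card
  · have hsub : (Finset.univ.filter fun i => (ω i).2.1 = (ω i).2.2) ⊆
        Finset.univ.filter fun i => bxor (bxor m (ω i).2.1) (ω i).2.2 = m :=
      Finset.monotone_filter_right _ fun i _ hi => by rw [hi, bxor_bxor_cancel_right]
    have hmaj := maj_eq_of_majority (fun i => bxor (bxor m (ω i).2.1) (ω i).2.2) m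
      (h.trans_le (Nat.mul_le_mul_left 2 (Finset.card_le_card hsub)))
    rw [if_pos h, if_pos hmaj]
  · rw [if_neg h]
    positivity

theorem correctness (hS : RealizesConstruction G S) {μ : ℕ → ℝ} (hμ : Tendsto μ atTop (𝓝 0))
    (hdet : Pseudodeterministic G μ) :
    ∃ ε : ℕ → ℝ, Negligible ε ∧ ∀ (n : ℕ) (m : Bits (ℓ n)), 1 - ε n ≤ S.correctProb n m := by
  have hev : ∀ᶠ n in atTop, ∀ m, 1 - S.correctProb n m ≤ (4 / 5 : ℝ) ^ n := by
    filter_upwards [hμ.eventually (Iic_mem_nhds (by norm_num : (0 : ℝ) < 1 / 16))] with n hn m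
    obtain ⟨K, hK, hKy⟩ := hdet n
    have hcoll : (15 / 16 : ℝ) ^ 3 ≤ collisionProb (G n) :=
      pow_three_le_collisionProb (G n) (by norm_num) (by linarith) fun k hk =>
        (hKy k hk).imp fun y hy => by linarith
    have hbase : 0 ≤ 2 - 3 / 2 * collisionProb (G n) := by
      linarith [collisionProb_le_one (G n)]
    have hpow := pow_le_pow_left₀ hbase (by linarith : _ ≤ (4 / 5 : ℝ)) n
    linarith [hS.correctProb_ge n m]
  obtain ⟨ε, hε, hle⟩ := (negligible_pow (by norm_num [abs_lt])).exists_forall_le hev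
  exact ⟨ε, hε, fun n m => sub_le_comm.1 (hle n m)⟩

end RealizesConstruction

end Scheme

/-! ### Feeding a challenge to an adversary -/

section Advice

variable {d a : ℕ}

/-- The isometry `|α⟩ ↦ |x⟩ ⊗ |α⟩`. -/
def prependMatrix (a : ℕ) (x : Bits d) : Matrix (Bits (d + a)) (Bits a) ℂ :=
  (1 : Matrix (Bits (d + a)) (Bits (d + a)) ℂ).submatrix id (Fin.append x)

theorem withAdvice_eq (x : Bits d) (ρ : Matrix (Bits a) (Bits a) ℂ) :
    withAdvice x ρ = prependMatrix a x * ρ * (prependMatrix a x)ᴴ := by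
  ext u v
  obtain ⟨⟨u₁, u₂⟩, rfl⟩ := (Fin.appendEquiv d a).surjective u
  obtain ⟨⟨v₁, v₂⟩, rfl⟩ := (Fin.appendEquiv d a).surjective v
  have hprepend (w₁ : Bits d) (w₂ α : Bits a) :
      prependMatrix a x (Fin.appendEquiv d a (w₁, w₂)) α =
        if α = w₂ then if x = w₁ then 1 else 0 else 0 := by
    change (1 : Matrix (Bits (d + a)) (Bits (d + a)) ℂ) (Fin.appendEquiv d a (w₁, w₂))
      (Fin.appendEquiv d a (x, α)) = _
    simp only [Matrix.one_apply, EmbeddingLike.apply_eq_iff_eq, Prod.mk.injEq,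
      eq_comm (a := w₁), eq_comm (a := w₂), and_comm (a := x = w₁), ite_and]
  simp only [Matrix.mul_apply, Matrix.conjTranspose_apply, hprepend, ite_mul, zero_mul,
    apply_ite star, star_zero, star_one, mul_ite, mul_zero, mul_one, one_mul, Finset.sum_ite_eq',
    Finset.mem_univ, if_true]
  simp only [withAdvice, Matrix.single_apply, ite_and, ite_mul, one_mul, zero_mul,
    Fin.appendEquiv, Equiv.coe_fn_mk, Matrix.of_apply, Fin.append_left, Fin.append_right]
  split_ifs <;> rfl

theorem trace_withAdvice_mul (x : Bits d) (ρ : Matrix (Bits a) (Bits a) ℂ)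
    (M : Matrix (Bits (d + a)) (Bits (d + a)) ℂ) :
    (withAdvice x ρ * M).trace = (ρ * M.submatrix (Fin.append x) (Fin.append x)).trace := by
  have hconj : (prependMatrix a x)ᴴ * M * prependMatrix a x =
      M.submatrix (Fin.append x) (Fin.append x) := by
    ext α β
    simp [prependMatrix, Matrix.mul_apply, Matrix.one_apply]
  rw [withAdvice_eq, ← hconj, Matrix.mul_assoc, Matrix.mul_assoc, Matrix.trace_mul_comm]
  simp only [Matrix.mul_assoc]

theorem IsDensity.withAdvice {ρ : Matrix (Bits a) (Bits a) ℂ} (hρ : IsDensity ρ) (x : Bits d) :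
    IsDensity (withAdvice x ρ) := by
  constructor
  · rw [withAdvice_eq]
    exact hρ.1.mul_mul_conjTranspose_same _
  · have hinj : Function.Injective (Fin.append x : Bits a → Bits (d + a)) := fun α β h =>
      (Prod.mk.inj ((Fin.appendEquiv d a).injective h)).2
    rw [← Matrix.mul_one (QCrypto.withAdvice x ρ), trace_withAdvice_mul,
      Matrix.submatrix_one _ hinj, Matrix.mul_one, hρ.2]

end Advice

section Effect

variable {U W ι ι' κ : Type*} [Fintype U] [Fintype W] [DecidableEq U] [DecidableEq W]

theorem evolve_map_inr_ket (L : List (WireGate W)) (z z' : U → Bool) (x x' : W → Bool) :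
    evolve (L.map (WireGate.map .inr)) (ket (Sum.elim z x)) (Sum.elim z' x') =
      if z' = z then evolve L (ket x) x' else 0 := by
  have hextend (u : W → Bool) :
      Function.extend (Function.Embedding.inr : W ↪ U ⊕ W) u (Sum.elim z' x') = Sum.elim z' u := by
    funext w
    rcases w with w | w
    · exact Function.extend_apply' _ _ _ fun ⟨_, h⟩ => Sum.inr_ne_inl h
    · exact Function.Embedding.inr.injective.extend_apply _ _ _
  have hslice : (fun u => ket (Sum.elim z x)
      (Function.extend (Function.Embedding.inr : W ↪ U ⊕ W) u (Sum.elim z' x'))) =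
        (if z' = z then 1 else 0 : ℂ) • ket x := by
    funext u
    simp [hextend, Pi.single_apply, Sum.elim_eq_iff, and_comm (a := z' = z), ite_and]
  rw [evolve_map, hslice, evolve_smul, Pi.smul_apply, smul_eq_mul, ite_mul, one_mul, zero_mul]
  rfl

theorem effect_append_map_inr [Fintype κ] {L₀ : List (WireGate (U ⊕ W))}
    {f : (U ⊕ W → Bool) → U ⊕ W → Bool} (hf : ∀ ψ v, evolve L₀ ψ (f v) = ψ v)
    (L : List (WireGate W)) (inp : ι ↪ U ⊕ W) (inp' : ι' ↪ W) (out : κ ↪ W) (y : κ → Bool)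
    {s t : ι → Bool} {s' t' : ι' → Bool} {z : U → Bool}
    (hs : f (initBits inp s) = Sum.elim z (initBits inp' s'))
    (ht : f (initBits inp t) = Sum.elim z (initBits inp' t')) :
    effect (L₀ ++ L.map (WireGate.map .inr)) inp (out.trans .inr) y s t =
      effect L inp' out y s' t' := by
  simp only [effect_apply, evolve_append, evolve_ket_of_evolve_eq hf, hs, ht]
  rw [← Equiv.sum_comp (Equiv.sumArrowEquivProdArrow U W Bool).symm, Fintype.sum_prod_type]
  change ∑ z', ∑ v, (if v ∘ out = y then
    star (evolve _ (ket (Sum.elim z _)) (Sum.elim z' v)) *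
      evolve _ (ket (Sum.elim z _)) (Sum.elim z' v) else 0) = _
  simp only [evolve_map_inr_ket]
  rw [Finset.sum_eq_single z (fun z' _ hz' => by simp [hz']) (by simp)]
  simp

end Effect

section Feed

variable {d l a m : ℕ}

/-- The string `c`, to whose bit `i` the bit `s i` of `z` (if any) is added. -/
def feed (s : Fin d → Option (Fin l)) (z : Bits l) (c : Bits d) : Bits d :=
  fun i => Bool.xor (c i) ((s i).elim false z)

theorem xorFamily_trans_inr {P U W : Type*} (e : P ↪ W) (F : P → (U ⊕ W → Bool) → Bool)
    (z : U → Bool) (x : W → Bool) :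
    xorFamily (e.trans .inr) F (Sum.elim z x) =
      Sum.elim z (xorFamily e (fun p y => F p (Sum.elim z y)) x) := by
  funext w
  rcases w with j | w
  · exact xorFamily_of_notMem _ _ _ fun _ => Sum.inr_ne_inl
  · by_cases hw : ∃ p, e p = w
    · obtain ⟨p, rfl⟩ := hw
      exact (xorFamily_apply (e.trans .inr) F _ p).trans
        (xorFamily_apply e (fun p y => F p (Sum.elim z y)) x p).symm
    · have hw' : ∀ p, e p ≠ w := fun p hp => hw ⟨p, hp⟩
      rw [Sum.elim_inr, xorFamily_of_notMem e _ _ hw',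
        xorFamily_of_notMem _ _ _ fun p hp => hw' p (Sum.inr_injective hp), Sum.elim_inr]

theorem xorFamily_initBits_append {W : Type*} (inp : Fin (d + a) ↪ W)
    (F : Fin d → (W → Bool) → Bool) (c : Bits d) (α : Bits a) :
    xorFamily ((Fin.castAddEmb a).trans inp) F (initBits inp (Fin.append c α)) =
      initBits inp
        (Fin.append (fun i => Bool.xor (c i) (F i (initBits inp (Fin.append c α)))) α) := by
  refine (eq_initBits_iff _ _ _).2 ⟨funext fun t => ?_, fun w hw => ?_⟩
  · refine Fin.addCases (fun i => ?_) (fun i => ?_) t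
    · refine (xorFamily_apply ((Fin.castAddEmb a).trans inp) F _ i).trans ?_
      simp
    · have hne (i' : Fin d) : Fin.castAdd a i' ≠ Fin.natAdd d i := Fin.ne_of_lt <|
        (Fin.castAdd_lt a i').trans_le (Nat.le_add_right d i)
      rw [Function.comp_apply, xorFamily_of_notMem _ _ _ fun i' h => hne i' (inp.injective h)]
      simp
  · rw [xorFamily_of_notMem ((Fin.castAddEmb a).trans inp) _ _ fun i => hw _,
      initBits_of_notMem _ _ hw]

theorem exists_implementable_feed {W : Type*} [DecidableEq W] (inp : Fin (d + a) ↪ W)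
    (s : Fin d → Option (Fin l)) :
    ∃ f : (Fin l ⊕ W → Bool) → Fin l ⊕ W → Bool, Implementable d f ∧
      ∀ z c α, f (Sum.elim z (initBits inp (Fin.append c α))) =
        Sum.elim z (initBits inp (Fin.append (feed s z c) α)) := by
  let e : Fin d ↪ Fin l ⊕ W := ((Fin.castAddEmb a).trans inp).trans .inr
  let F (i : Fin d) (v : Fin l ⊕ W → Bool) : Bool := (s i).elim false fun j => v (Sum.inl j)
  have hB (i : Fin d) : Implementable 1 (xorOp (e i) (F i)) := by
    cases hi : s i with
    | none =>
      have hid : xorOp (e i) (F i) = id := by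
        funext v
        simp [xorOp, F, hi]
      exact hid ▸ Implementable.id.mono zero_le_one
    | some j =>
      have hcnot : F i = fun v => v (Sum.inl j) := by simp [F, hi]
      exact hcnot ▸ implementable_cnot Sum.inl_ne_inr
  have hF (i i' : Fin d) (v : Fin l ⊕ W → Bool) (b : Bool) :
      F i' (Function.update v (e i) b) = F i' v := by
    simp [F, e]
  refine ⟨xorFamily e F, by simpa using implementable_xorFamily hB hF, fun z c α => ?_⟩
  rw [xorFamily_trans_inr, xorFamily_initBits_append]
  rfl

theorem exists_feed_circuit (C : QCircuit (d + a) m) (s : Fin d → Option (Fin l)) :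
    ∃ B : QCircuit (l + (d + a)) m, B.size ≤ 2 * C.size + 2 * l ∧ ∀ z c ρ y,
      B.channel (withAdvice z (withAdvice c ρ)) y y =
        C.channel (withAdvice (feed s z c) ρ) y y := by
  obtain ⟨f, ⟨L, hL, hLf⟩, hf⟩ := exists_implementable_feed C.inp s
  let inp := appendInp (Function.Embedding.refl (Fin l)) C.inp
  have hinit (z : Bits l) (c : Bits d) (α : Bits a) :
      f (initBits inp (Fin.append z (Fin.append c α))) =
        Sum.elim z (initBits C.inp (Fin.append (feed s z c) α)) := by
    rw [initBits_appendInp, initBits_refl, hf]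
  refine ⟨circuitOf (L ++ C.wireGates.map (WireGate.map .inr)) inp (C.out.trans .inr), ?_,
    fun z c ρ y => ?_⟩
  · have hinputs := C.inputs_le_size
    rw [size_circuitOf, List.length_append, List.length_map, Fintype.card_sum, Fintype.card_fin,
      Fintype.card_fin, QCircuit.wireGates, List.length_map]
    rw [QCircuit.size] at hinputs ⊢
    lia
  · rw [channel_circuitOf_self, C.channel_self, trace_withAdvice_mul, trace_withAdvice_mul,
      trace_withAdvice_mul]
    congr 2
    ext α β
    exact effect_append_map_inr hLf _ _ _ _ _ (hinit z c α) (hinit z c β)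

theorem Adversary.exists_feed {d ℓ : ℕ → ℕ} {p : Polynomial ℕ} (hℓ : ∀ n, ℓ n ≤ p.eval n)
    (A : Adversary d) (s : ∀ n, Fin (d n) → Option (Fin (ℓ n))) (c : ∀ n, Bits (d n)) :
    ∃ A' : Adversary ℓ, ∀ n z, A'.accept n z = A.accept n (feed (s n) z (c n)) := by
  choose B hB hchannel using fun n => exists_feed_circuit (A.circuit n) (s n)
  obtain ⟨q, hq⟩ := A.isQPT
  have hQPT : IsQPT B := ⟨2 * q + 2 * p, fun n => (hB n).trans <| by
    simpa using add_le_add (Nat.mul_le_mul_left 2 (hq n)) (Nat.mul_le_mul_left 2 (hℓ n))⟩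
  exact ⟨⟨_, B, fun n => withAdvice (c n) (A.advice n), hQPT,
    fun n => (A.isDensity n).withAdvice (c n)⟩,
    fun n z => congrArg Complex.re (hchannel n z (c n) (A.advice n) _)⟩

end Feed

/-! ### Security -/

section Hybrid

variable {α : Type*} [Fintype α]

theorem abs_sum_mul_sub_sum_mul_le {w f f' : α → ℝ} {e : ℝ} (hw : ∀ x, 0 ≤ w x)
    (hsum : ∑ x, w x = 1) (h : ∀ x, |f x - f' x| ≤ e) :
    |∑ x, w x * f x - ∑ x, w x * f' x| ≤ e := by
  calc |∑ x, w x * f x - ∑ x, w x * f' x| = |∑ x, w x * (f x - f' x)| := by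
        simp only [mul_sub, Finset.sum_sub_distrib]
    _ ≤ ∑ x, |w x * (f x - f' x)| := Finset.abs_sum_le_sum_abs _ _
    _ ≤ ∑ x, w x * e := Finset.sum_le_sum fun x _ => by
        rw [abs_mul, abs_of_nonneg (hw x)]
        exact mul_le_mul_of_nonneg_left (h x) (hw x)
    _ = e := by rw [← Finset.sum_mul, hsum, one_mul]

theorem sum_prod_mul_succ {r : ℕ} (w : α → ℝ) (g : (Fin (r + 1) → α) → ℝ) :
    ∑ y, (∏ i, w (y i)) * g y =
      ∑ z, w z * ∑ y : Fin r → α, (∏ i, w (y i)) * g (Fin.cons z y) := by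
  rw [← (Fin.consEquiv fun _ => α).sum_comp, Fintype.sum_prod_type]
  simp only [Fin.consEquiv, Equiv.coe_fn_mk, Fin.prod_univ_succ, Fin.cons_zero, Fin.cons_succ,
    mul_assoc, Finset.mul_sum]

/-- The hybrid argument: the coordinates are replaced one at a time. -/
theorem abs_sum_prod_mul_sub_le {q u : α → ℝ} {ε : ℝ} (hq : ∀ x, 0 ≤ q x)
    (hq_sum : ∑ x, q x = 1) (hu : ∀ x, 0 ≤ u x) (hu_sum : ∑ x, u x = 1) {r : ℕ}
    {g : (Fin r → α) → ℝ}
    (h : ∀ j y, |∑ z, q z * g (Function.update y j z) - ∑ z, u z * g (Function.update y j z)| ≤ ε) :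
    |∑ y, (∏ i, q (y i)) * g y - ∑ y, (∏ i, u (y i)) * g y| ≤ r * ε := by
  induction r with
  | zero => simp
  | succ r ih =>
    have htail : |∑ z, q z * ∑ y : Fin r → α, (∏ i, q (y i)) * g (Fin.cons z y) -
        ∑ z, q z * ∑ y : Fin r → α, (∏ i, u (y i)) * g (Fin.cons z y)| ≤ r * ε :=
      abs_sum_mul_sub_sum_mul_le hq hq_sum fun z => ih fun j y => by
        simpa only [Fin.cons_update] using h j.succ (Fin.cons z y)
    have hhead : |∑ y : Fin r → α, (∏ i, u (y i)) * ∑ z, q z * g (Fin.cons z y) -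
        ∑ y : Fin r → α, (∏ i, u (y i)) * ∑ z, u z * g (Fin.cons z y)| ≤ ε := by
      refine abs_sum_mul_sub_sum_mul_le (fun y => Finset.prod_nonneg fun i _ => hu _)
        (by rw [← Fintype.sum_pow, hu_sum, one_pow]) fun y => ?_
      obtain ⟨x⟩ : Nonempty α := by
        by_contra hα
        simp [not_nonempty_iff.1 hα] at hq_sum
      simpa only [Fin.update_cons_zero] using h 0 (Fin.cons x y)
    have hswap (w : α → ℝ) : ∑ y : Fin r → α, (∏ i, u (y i)) * ∑ z, w z * g (Fin.cons z y) =
        ∑ z, w z * ∑ y : Fin r → α, (∏ i, u (y i)) * g (Fin.cons z y) := by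
      simp only [Finset.mul_sum]
      rw [Finset.sum_comm]
      simp only [mul_left_comm]
    rw [hswap, hswap] at hhead
    rw [sum_prod_mul_succ, sum_prod_mul_succ, Nat.cast_succ, add_one_mul]
    exact (abs_sub_le _ _ _).trans (add_le_add htail hhead)

end Hybrid

section OutputDist

variable {n l : ℕ}

/-- The output distribution of `C` on a uniformly random input. -/
noncomputable def outputDist (C : QCircuit n l) (y : Bits l) : ℝ :=
  ∑ k, 1 / 2 ^ n * C.prob k y

theorem outputDist_nonneg (C : QCircuit n l) (y : Bits l) : 0 ≤ outputDist C y :=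
  Finset.sum_nonneg fun _ _ => mul_nonneg (by positivity) (C.prob_nonneg _ _)

theorem sum_outputDist (C : QCircuit n l) : ∑ y, outputDist C y = 1 := by
  simp only [outputDist]
  rw [Finset.sum_comm]
  simp [← Finset.mul_sum, C.sum_prob]

theorem prod_outputDist (C : QCircuit n l) {r : ℕ} (y : Fin r → Bits l) :
    ∏ i, outputDist C (y i) =
      ∑ k : Bits (r * n), 1 / 2 ^ (r * n) * ∏ i, C.prob (block k i) (y i) := by
  rw [← (blockEquiv r n).symm.sum_comp]
  simp only [outputDist, Fintype.prod_sum, Finset.prod_mul_distrib, Finset.prod_const,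
    Finset.card_univ, Fintype.card_fin, one_div_pow, ← pow_mul, mul_comm n r]
  refine Finset.sum_congr rfl fun k _ => ?_
  congr! 4
  exact ((blockEquiv r n).apply_symm_apply k).symm

theorem prgReal_eq {ℓ : ℕ → ℕ} (G : ∀ n, QCircuit n (ℓ n)) (A : Adversary ℓ) (n : ℕ) :
    prgReal G A n = ∑ y, outputDist (G n) y * A.accept n y := by
  simp only [prgReal, outputDist, Finset.sum_mul, Finset.mul_sum]
  rw [Finset.sum_comm]
  simp only [mul_assoc]

/-- Adding `m` to every block. -/
def bxorEquiv (r : ℕ) (m : Bits l) : Equiv.Perm (Fin r → Bits l) :=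
  Function.Involutive.toPerm (fun y i => bxor m (y i)) fun y => by
    funext i t
    simp [bxor]

/-- The choice of bits for `feed` that adds a string to block `j`. -/
def blockSelector {r : ℕ} (j : Fin r) (t : Fin (r * l)) : Option (Fin l) :=
  if (finProdFinEquiv.symm t).1 = j then some (finProdFinEquiv.symm t).2 else none

theorem feed_blockSelector {r : ℕ} (j : Fin r) (y : Fin r → Bits l) (m z : Bits l) :
    feed (blockSelector j) z (concat (Function.update (fun i => bxor m (y i)) j m)) =
      concat fun i => bxor m (Function.update y j z i) := by
  funext t
  by_cases h : (finProdFinEquiv.symm t).1 = j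
  · simp [feed, blockSelector, concat, bxor, -finProdFinEquiv_symm_apply, h]
  · simp [feed, blockSelector, concat, bxor, -finProdFinEquiv_symm_apply, h]

end OutputDist

section Scheme

variable {ℓ : ℕ → ℕ} {G : ∀ n, QCircuit n (ℓ n)}

/-- Non-uniformity: the distinguisher uses the worst choice for every security parameter. -/
theorem exists_negligible_feed (hG : IsQPT G)
    (hsec : ∀ A : Adversary ℓ, ∃ ε, Negligible ε ∧
      ∀ᶠ n in atTop, |prgReal G A n - prgIdeal A n| ≤ ε n)
    {d : ℕ → ℕ} (A : Adversary d) :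
    ∃ ε, Negligible ε ∧ ∀ᶠ n in atTop, ∀ (s : Fin (d n) → Option (Fin (ℓ n))) (c : Bits (d n)),
      |∑ z, outputDist (G n) z * A.accept n (feed s z c) -
        ∑ z : Bits (ℓ n), 1 / 2 ^ ℓ n * A.accept n (feed s z c)| ≤ ε n := by
  obtain ⟨p, hp⟩ := hG
  choose worst hworst using fun n => Finite.exists_max
    fun x : (Fin (d n) → Option (Fin (ℓ n))) × Bits (d n) =>
      |∑ z, outputDist (G n) z * A.accept n (feed x.1 z x.2) -
        ∑ z : Bits (ℓ n), 1 / 2 ^ ℓ n * A.accept n (feed x.1 z x.2)|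
  obtain ⟨A', hA'⟩ := A.exists_feed (fun n => (G n).outputs_le_size.trans (hp n))
    (fun n => (worst n).1) fun n => (worst n).2
  obtain ⟨ε, hε, hev⟩ := hsec A'
  refine ⟨ε, hε, hev.mono fun n hn s c => (hworst n (s, c)).trans ?_⟩
  simpa only [prgReal_eq, prgIdeal, hA'] using hn

variable {S : EncScheme (fun n => n * n) ℓ (fun n => n * ℓ n)}

namespace RealizesConstruction

theorem acceptProb_eq (hS : RealizesConstruction G S) (A : Adversary fun n => n * ℓ n) (n : ℕ)
    (m : Bits (ℓ n)) :
    S.acceptProb A n m = ∑ y : Fin n → Bits (ℓ n),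
      (∏ i, outputDist (G n) (y i)) * A.accept n (concat fun i => bxor m (y i)) := by
  simp only [EncScheme.acceptProb, hS.gen, hS.sum_encProb_mul, prod_outputDist, parallelProb,
    Finset.mul_sum, Finset.sum_mul, mul_assoc]
  exact Finset.sum_comm

theorem abs_acceptProb_sub_le (hS : RealizesConstruction G S) (A : Adversary fun n => n * ℓ n)
    {n : ℕ} {ε : ℝ}
    (h : ∀ s c, |∑ z, outputDist (G n) z * A.accept n (feed s z c) -
      ∑ z : Bits (ℓ n), 1 / 2 ^ ℓ n * A.accept n (feed s z c)| ≤ ε) (m : Bits (ℓ n)) :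
    |S.acceptProb A n m - ∑ y : Fin n → Bits (ℓ n),
      (∏ _i : Fin n, 1 / 2 ^ ℓ n) * A.accept n (concat y)| ≤ n * ε := by
  rw [hS.acceptProb_eq, ← Equiv.sum_comp (bxorEquiv n m) fun y : Fin n → Bits (ℓ n) =>
    (∏ _i : Fin n, (1 / 2 ^ ℓ n : ℝ)) * A.accept n (concat y)]
  refine abs_sum_prod_mul_sub_le (u := fun _ => 1 / 2 ^ ℓ n)
    (g := fun y => A.accept n (concat fun i => bxor m (y i)))
    (outputDist_nonneg _) (sum_outputDist _) (fun _ => by positivity) (by simp) fun j y => ?_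
  simp only [← feed_blockSelector]
  exact h _ _

theorem security (hS : RealizesConstruction G S) (hG : IsQPT G)
    (hsec : ∀ A : Adversary ℓ, ∃ ε, Negligible ε ∧
      ∀ᶠ n in atTop, |prgReal G A n - prgIdeal A n| ≤ ε n)
    (A : Adversary fun n => n * ℓ n) :
    ∃ ε, Negligible ε ∧ ∀ (n : ℕ) (m₀ m₁ : Bits (ℓ n)),
      |S.acceptProb A n m₀ - S.acceptProb A n m₁| ≤ ε n := by
  obtain ⟨ε, hε, hfeed⟩ := exists_negligible_feed hG hsec A
  have hev : ∀ᶠ n in atTop, ∀ m : Bits (ℓ n) × Bits (ℓ n),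
      |S.acceptProb A n m.1 - S.acceptProb A n m.2| ≤ 2 * (n * ε n) := by
    filter_upwards [hfeed] with n hn m
    have hideal := hS.abs_acceptProb_sub_le A hn
    rw [two_mul]
    exact (abs_sub_le _ _ _).trans <|
      add_le_add (hideal m.1) ((abs_sub_comm _ _).trans_le (hideal m.2))
  obtain ⟨ε', hε', hle⟩ := Negligible.exists_forall_le (hε.param_mul.const_mul 2) hev
  exact ⟨ε', hε', fun n m₀ m₁ => hle n (m₀, m₁)⟩

end RealizesConstruction

end Scheme

end QCrypto

theorem mainTheorem6_general {ℓ : ℕ → ℕ} {G : ∀ n, QCrypto.QCircuit n (ℓ n)}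
    (hG : QCrypto.IsQPT G) {μ : ℕ → ℝ} (hμ : Filter.Tendsto μ Filter.atTop (nhds 0))
    (hdet : QCrypto.Pseudodeterministic G μ)
    (hsec : ∀ A : QCrypto.Adversary ℓ, ∃ ε, QCrypto.Negligible ε ∧
      ∀ᶠ n in Filter.atTop, |QCrypto.prgReal G A n - QCrypto.prgIdeal A n| ≤ ε n)
    (hℓ : ∀ n, n ^ 2 < ℓ n) :
    ∃ S : QCrypto.EncScheme (fun n => n * n) ℓ (fun n => n * ℓ n),
      QCrypto.RealizesConstruction G S ∧ S.IsPOTP := by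
  obtain ⟨S, hS, hGen, hEnc, hDec⟩ := QCrypto.exists_scheme hG
  exact ⟨S, hS, hGen, hEnc, hDec, hS.correctness hμ hdet, fun n => sq n ▸ hℓ n,
    hS.security hG hsec⟩

theorem mainTheorem6 (ℓ : ℕ → ℕ) (G : ∀ n : ℕ, QCrypto.QCircuit n (ℓ n))
    (hG : QCrypto.IsStrongQPRG G) (hℓ : ∀ n : ℕ, n ^ 2 < ℓ n) :
    ∃ S : QCrypto.EncScheme (fun n => n * n) ℓ (fun n => n * ℓ n),
      QCrypto.RealizesConstruction G S ∧ S.IsPOTP := by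
  obtain ⟨c, hc, μ, hμ, hdet⟩ := hG.pseudodeterminism
  exact mainTheorem6_general hG.isQPT (hμ.trans_tendsto <|
    (tendsto_rpow_neg_atTop hc).comp tendsto_natCast_atTop_atTop) hdet hG.strongSecurity hℓ
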